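/- Let $\Lambda\subseteq\mathbb R$ be nonempty. A weight matrix over $\Lambda$ is a family $\mathfrak M=\{M^\lambda:\lambda\in\Lambda\}$ of sequences $M^\lambda=(M^\lambda_k)_{k\ge 0}$ of positive reals such that, for each $\lambda$, $(k!M^\lambda_k)_k$ is log-convex, $M^\lambda_0=1$, $\lim_k (k!M^\lambda_k)^{1/k}=\infty$, and $M^\lambda_k\le M^\mu_k$ for all $k$ whenever $\lambda\le\mu$. For a positive sequence $M$, $\rho>0$ and compact $K$, put $\|f\|^{M}_{K,\rho}=\sup_{x\in K,\,k\in\mathbb N}\frac{\|f^{(k)}(x)\|}{k!\,\rho^kM_k}$, where $f^{(k)}$ is the $k$-th Fréchet derivative with the operator norm. For $U\subseteq\mathbb R^n$ open, $\mathcal E^{(\mathfrak M)}(U,\mathbb R^m)$ (the Beurling class) consists of all $f\in C^\infty(U,\mathbb R^m)$ with $\|f\|^{M^\lambda}_{K,\rho}<\infty$ for all $\lambda\in\Lambda$, all compact $K\subseteq U$ and all $\rho>0$; $\mathcal E^{\{\mathfrak M\}}(U,\mathbb R^m)$ (the Roumieu class) consists of all $f\in C^\infty(U,\mathbb R^m)$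 such that for each compact $K\subseteq U$ there are $\lambda\in\Lambda$ and $\rho>0$ with $\|f\|^{M^\lambda}_{K,\rho}<\infty$. For compact $K$ with smooth boundary let $\mathcal E^{M}_\rho(K,\mathbb R^m)=\{f\in C^\infty(K,\mathbb R^m):\|f\|^M_{K,\rho}<\infty\}$, a normed space with norm $\|\cdot\|^M_{K,\rho}$. With $K$ ranging over the compact subsets of $U$ with smooth boundary, $\mathcal E^{(\mathfrak M)}(U,\mathbb R^m)$ carries the projective limit topology over $(\lambda,K,\rho)$ of the spaces $\mathcal E^{M^\lambda}_\rho(K,\mathbb R^m)$, and $\mathcal E^{\{\mathfrak M\}}(U,\mathbb R^m)$ the projective limit topology over $K$ of the locally convex inductive limits $\mathcal E^{\{\mathfrak M\}}(K,\mathbb R^m)=\varinjlim_{(\lambda,\rho)}\mathcal E^{M^\lambda}_\rho(K,\mathbb R^m)$. For two such classes, $\mathcal F\subseteq\mathcal G$ means $\mathcal F(U,\mathbb R^m)\subseteq\mathcal G(U,\mathbb R^m)$ for all $n,m\ge 1$ and all open $U\subseteq\mathbb R^n$; $\mathcal F(\mathbb R)$ denotes $\mathcal F(\mathbb R,\mathbb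 R)$. For positive sequences, $M\preceq N$ means $\exists C,\rho>0\ \forall k: M_k\le C\rho^kN_k$, and $M\triangleleft N$ means $\forall\rho>0\ \exists C>0\ \forall k: M_k\le C\rho^kN_k$. For weight matrices $\mathfrak M,\mathfrak N$ over $\Lambda$ define $\mathfrak M(\preceq)\mathfrak N:\Leftrightarrow\forall\lambda\,\exists\mu: M^\mu\preceq N^\lambda$; $\mathfrak M\{\preceq\}\mathfrak N:\Leftrightarrow\forall\lambda\,\exists\mu: M^\lambda\preceq N^\mu$; $\mathfrak M\{\triangleleft)\mathfrak N:\Leftrightarrow\forall\lambda\,\forall\mu: M^\lambda\triangleleft N^\mu$; $\mathfrak M(\preceq\}\mathfrak N:\Leftrightarrow\exists\lambda\,\exists\mu: M^\lambda\preceq N^\mu$. **Proposition.** Let $\mathfrak M,\mathfrak N$ be weight matrices over the same $\Lambda$. Then 1. $\mathfrak M(\preceq)\mathfrak N\iff\mathcal E^{(\mathfrak M)}\subseteq\mathcal E^{(\mathfrak N)}\iff\mathcal E^{(\mathfrak M)}(\mathbb R)\subseteq\mathcal E^{(\mathfrak N)}(\mathbb R)$, and $\mathfrak M\{\preceq\}\mathfrak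 N\iff\mathcal E^{\{\mathfrak M\}}\subseteq\mathcal E^{\{\mathfrak N\}}\iff\mathcal E^{\{\mathfrak M\}}(\mathbb R)\subseteq\mathcal E^{\{\mathfrak N\}}(\mathbb R)$; 2. $\mathfrak M\{\triangleleft)\mathfrak N\iff\mathcal E^{\{\mathfrak M\}}\subseteq\mathcal E^{(\mathfrak N)}\iff\mathcal E^{\{\mathfrak M\}}(\mathbb R)\subseteq\mathcal E^{(\mathfrak N)}(\mathbb R)$; 3. $\mathfrak M(\preceq\}\mathfrak N\iff\mathcal E^{(\mathfrak M)}\subseteq\mathcal E^{\{\mathfrak N\}}\iff\mathcal E^{(\mathfrak M)}(\mathbb R)\subseteq\mathcal E^{\{\mathfrak N\}}(\mathbb R)$. Moreover, whenever these inclusions hold, they are all continuous. -/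

import Mathlib

open scoped Nat ENNReal ContDiff Topology

/-! ### Weight sequences and weight matrices -/

/-- `M ≼ N` for sequences of positive reals. -/
def SeqDominated (M N : ℕ → ℝ) : Prop :=
  ∃ C > (0 : ℝ), ∃ ρ > (0 : ℝ), ∀ k : ℕ, M k ≤ C * ρ ^ k * N k

/-- `M ◁ N` for sequences of positive reals. -/
def SeqStrictlyDominated (M N : ℕ → ℝ) : Prop :=
  ∀ ρ > (0 : ℝ), ∃ C > (0 : ℝ), ∀ k : ℕ, M k ≤ C * ρ ^ k * N k

/-- A weight matrix `𝔐 = {M^λ : λ ∈ Λ}` indexed by a (nonempty) ordered subset `Λ` of `ℝ`: a family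
of positive sequences such that `(k! M_k^λ)_k` is log-convex, `M_0^λ = 1`,
`(k! M_k^λ)^{1/k} → ∞`, and `M^λ ≤ M^μ` whenever `λ ≤ μ`. -/
structure WeightMatrix (Λ : Set ℝ) where
  seq : Λ → ℕ → ℝ
  nonempty : Λ.Nonempty
  pos : ∀ l k, 0 < seq l k
  weaklyLogConvex : ∀ l (k : ℕ),
    (((k + 1)! : ℝ) * seq l (k + 1)) ^ 2 ≤ ((k ! : ℝ) * seq l k) * (((k + 2)! : ℝ) * seq l (k + 2))
  seq_zero : ∀ l, seq l 0 = 1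
  tendsto_root : ∀ l, Filter.Tendsto (fun k : ℕ => ((k ! : ℝ) * seq l k) ^ (1 / (k : ℝ)))
    Filter.atTop Filter.atTop
  mono : ∀ l m, l ≤ m → ∀ k, seq l k ≤ seq m k

namespace WeightMatrix

variable {Λ : Set ℝ}

/-- `𝔐 (≼) 𝔑`: for every `λ` there is `μ` with `M^μ ≼ N^λ`. -/
def BeurlingDominated (𝔐 𝔑 : WeightMatrix Λ) : Prop :=
  ∀ l, ∃ m, SeqDominated (𝔐.seq m) (𝔑.seq l)

/-- `𝔐 {≼} 𝔑`: for every `λ` there is `μ` with `M^λ ≼ N^μ`. -/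
def RoumieuDominated (𝔐 𝔑 : WeightMatrix Λ) : Prop :=
  ∀ l, ∃ m, SeqDominated (𝔐.seq l) (𝔑.seq m)

/-- `𝔐 (≼} 𝔑`: there are `λ` and `μ` with `M^λ ≼ N^μ`. -/
def BeurlingRoumieuDominated (𝔐 𝔑 : WeightMatrix Λ) : Prop :=
  ∃ l m, SeqDominated (𝔐.seq l) (𝔑.seq m)

/-- `𝔐 {◁) 𝔑`: for all `λ` and `μ`, `M^λ ◁ N^μ`. -/
def RoumieuBeurlingDominated (𝔐 𝔑 : WeightMatrix Λ) : Prop :=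
  ∀ l m, SeqStrictlyDominated (𝔐.seq l) (𝔑.seq m)

end WeightMatrix

/-! ### Smooth functions and the norms -/

section Spaces

variable {E F : Type*} [NormedAddCommGroup E] [NormedSpace ℝ E]
  [NormedAddCommGroup F] [NormedSpace ℝ F]

/-- `C^∞(S, F)` for a set `S ⊆ E`. A function on `S` is encoded by its extension by zero to `E`. -/
def smoothFunctions (F : Type*) [NormedAddCommGroup F] [NormedSpace ℝ F] (S : Set E) :
    Submodule ℝ (E → F) where
  carrier := {f | ContDiffOn ℝ ∞ f S ∧ ∀ x ∉ S, f x = 0}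
  add_mem' := fun {f g} hf hg => ⟨hf.1.add hg.1, fun x hx => by simp [hf.2 x hx, hg.2 x hx]⟩
  zero_mem' := ⟨contDiffOn_const, fun _ _ => rfl⟩
  smul_mem' := fun c f hf => ⟨hf.1.const_smul c, fun x hx => by simp [hf.2 x hx]⟩

/-- The extended norm `sup_{x ∈ K, k ∈ ℕ} ‖f^{(k)}(x)‖ / (k! ρ^k M_k)` of a function `f` that is
smooth on `S`, where `K ⊆ S`. The derivatives are taken within `S`; they are the usual Fréchet
derivatives when `S` is open, and the continuous extensions to the boundary of the derivatives in
the interior when `S` is a compact set with smooth boundary. -/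
noncomputable def ultraENorm (S K : Set E) (M : ℕ → ℝ) (ρ : ℝ) (f : E → F) : ℝ≥0∞ :=
  ⨆ x ∈ K, ⨆ k : ℕ,
    ‖iteratedFDerivWithin ℝ k f S x‖ₑ / ENNReal.ofReal ((k ! : ℝ) * ρ ^ k * M k)

theorem ultraENorm_zero (S K : Set E) (M : ℕ → ℝ) (ρ : ℝ) :
    ultraENorm S K M ρ (0 : E → F) = 0 := by
  refine le_antisymm (iSup₂_le fun x _ => iSup_le fun k => ?_) zero_le
  have h : iteratedFDerivWithin ℝ k (0 : E → F) S x = 0 :=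
    congrFun iteratedFDerivWithin_fun_zero x
  have h' : ‖iteratedFDerivWithin ℝ k (0 : E → F) S x‖ₑ = 0 := by
    rw [h, ← ofReal_norm, norm_zero, ENNReal.ofReal_zero]
  rw [h', ENNReal.zero_div]

theorem ultraENorm_add_le {S K : Set E} (hS : UniqueDiffOn ℝ S) (hK : K ⊆ S) (M : ℕ → ℝ) (ρ : ℝ)
    {f g : E → F} (hf : f ∈ smoothFunctions F S) (hg : g ∈ smoothFunctions F S) :
    ultraENorm S K M ρ (f + g) ≤ ultraENorm S K M ρ f + ultraENorm S K M ρ g := by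
  refine iSup₂_le fun x hx => iSup_le fun k => ?_
  rw [iteratedFDerivWithin_add_apply ((hf.1 x (hK hx)).of_le (by exact_mod_cast le_top))
    ((hg.1 x (hK hx)).of_le (by exact_mod_cast le_top)) hS (hK hx)]
  refine (ENNReal.div_le_div_right
    (enorm_add_le (iteratedFDerivWithin ℝ k f S x) (iteratedFDerivWithin ℝ k g S x)) _).trans ?_
  rw [ENNReal.add_div]
  exact add_le_add
    ((le_iSup (fun k : ℕ => ‖iteratedFDerivWithin ℝ k f S x‖ₑ /
      ENNReal.ofReal ((k ! : ℝ) * ρ ^ k * M k)) k).trans (le_iSup₂_of_le x hx le_rfl))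
    ((le_iSup (fun k : ℕ => ‖iteratedFDerivWithin ℝ k g S x‖ₑ /
      ENNReal.ofReal ((k ! : ℝ) * ρ ^ k * M k)) k).trans (le_iSup₂_of_le x hx le_rfl))

theorem ultraENorm_smul {S K : Set E} (hS : UniqueDiffOn ℝ S) (hK : K ⊆ S) (M : ℕ → ℝ) (ρ : ℝ)
    (c : ℝ) {f : E → F} (hf : f ∈ smoothFunctions F S) :
    ultraENorm S K M ρ (c • f) = ‖c‖ₑ * ultraENorm S K M ρ f := by
  simp only [ultraENorm, ENNReal.mul_iSup]
  refine iSup_congr fun x => iSup_congr fun hx => iSup_congr fun k => ?_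
  rw [iteratedFDerivWithin_const_smul_apply ((hf.1 x (hK hx)).of_le (by exact_mod_cast le_top))
    hS (hK hx), enorm_smul, mul_div_assoc]

/-- The norm decreases when the weights increase. -/
theorem ultraENorm_anti (S K : Set E) {M N : ℕ → ℝ} {ρ σ : ℝ} (hM : ∀ k, 0 < M k)
    (hMN : ∀ k, M k ≤ N k) (hρ : 0 < ρ) (hρσ : ρ ≤ σ) (f : E → F) :
    ultraENorm S K N σ f ≤ ultraENorm S K M ρ f := by
  refine iSup₂_mono fun x _ => iSup_mono fun k => ?_
  refine ENNReal.div_le_div_left (ENNReal.ofReal_le_ofReal ?_) _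
  have h1 := hM k
  have h2 := hMN k
  have h3 : 0 < σ := hρ.trans_le hρσ
  gcongr

/-- Restriction of functions to a smaller set. -/
theorem indicator_mem_smoothFunctions {S K : Set E} (hK : K ⊆ S) {f : E → F}
    (hf : f ∈ smoothFunctions F S) : K.indicator f ∈ smoothFunctions F K :=
  ⟨(hf.1.mono hK).congr fun _ hx => Set.indicator_of_mem hx f,
    fun _ hx => Set.indicator_of_notMem hx f⟩

theorem ultraENorm_indicator {S K : Set E} (hS : UniqueDiffOn ℝ S) (hK : UniqueDiffOn ℝ K)
    (hKS : K ⊆ S) (M : ℕ → ℝ) (ρ : ℝ) {f : E → F} (hf : f ∈ smoothFunctions F S) :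
    ultraENorm K K M ρ (K.indicator f) = ultraENorm S K M ρ f := by
  refine iSup_congr fun x => iSup_congr fun hx => iSup_congr fun k => ?_
  rw [iteratedFDerivWithin_congr (fun y hy => Set.indicator_of_mem hy f) hx k,
    iteratedFDerivWithin_subset (n := k) hKS hK hS
      (hf.1.of_le (by exact_mod_cast le_top)) hx]

/-! ### Compact sets with smooth boundary -/

/-- `K` has smooth boundary: near each boundary point it is a sublevel set `{r ≤ 0}` of a smooth
function with nonvanishing differential at that point. -/
def HasSmoothBoundary (K : Set E) : Prop :=
  ∀ x ∈ frontier K, ∃ r : E → ℝ, ContDiff ℝ ∞ r ∧ fderiv ℝ r x ≠ 0 ∧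
    ∀ᶠ y in 𝓝 x, (y ∈ K ↔ r y ≤ 0)

theorem HasSmoothBoundary.uniqueDiffOn {K : Set E} (h : HasSmoothBoundary K) :
    UniqueDiffOn ℝ K := by
  intro x hx
  by_cases hi : x ∈ interior K
  · exact uniqueDiffWithinAt_of_mem_nhds (mem_interior_iff_mem_nhds.mp hi)
  obtain ⟨r, hr, hd, hK⟩ := h x ⟨subset_closure hx, hi⟩
  have hrx : r x ≤ 0 := hK.self_of_nhds.mp hx
  have hdiff : HasFDerivAt r (fderiv ℝ r x) x :=
    (hr.differentiable (by simp) x).hasFDerivAt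
  have cone : ∀ v, fderiv ℝ r x v < 0 → v ∈ tangentConeAt ℝ K x := by
    intro v hv
    refine mem_tangentConeAt_of_add_smul_mem (c := fun t : ℝ => t) (l := 𝓝[>] (0 : ℝ))
      (nhdsGT_le_nhdsNE 0) ?_
    have hline : HasDerivAt (fun t : ℝ => x + t • v) v 0 := by
      simpa using ((hasDerivAt_id (0 : ℝ)).smul_const v).const_add x
    have hcomp : HasDerivAt (fun t : ℝ => r (x + t • v)) (fderiv ℝ r x v) 0 := by
      have : HasFDerivAt r (fderiv ℝ r x) (x + (0 : ℝ) • v) := by simpa using hdiff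
      exact this.comp_hasDerivAt (0 : ℝ) hline
    have hslope := (hasDerivAt_iff_tendsto_slope.mp hcomp).eventually (gt_mem_nhds hv)
    have hslope' := hslope.filter_mono (nhdsGT_le_nhdsNE (0 : ℝ))
    have hmem : ∀ᶠ t : ℝ in 𝓝[>] 0, (x + t • v ∈ K ↔ r (x + t • v) ≤ 0) := by
      have hc : Filter.Tendsto (fun t : ℝ => x + t • v) (𝓝 0) (𝓝 x) := by
        simpa using hline.continuousAt.tendsto
      exact (hc.eventually hK).filter_mono nhdsWithin_le_nhds
    filter_upwards [hslope', hmem, self_mem_nhdsWithin] with t h1 h2 h3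
    rw [h2]
    have ht : (0 : ℝ) < t := h3
    simp only [slope_def_field, sub_zero, zero_smul, add_zero] at h1
    have := (div_lt_iff₀ ht).mp h1
    linarith
  obtain ⟨w, hw⟩ : ∃ w, fderiv ℝ r x w ≠ 0 := by
    by_contra! hcon
    exact hd (ContinuousLinearMap.ext hcon)
  obtain ⟨v, hv⟩ : ∃ v, fderiv ℝ r x v < 0 := by
    rcases lt_or_gt_of_ne hw with h1 | h1
    · exact ⟨w, h1⟩
    · exact ⟨-w, by simpa using h1⟩
  refine ⟨?_, subset_closure hx⟩
  have htop : Submodule.span ℝ (tangentConeAt ℝ K x) = ⊤ := by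
    refine eq_top_iff.mpr fun u _ => ?_
    obtain ⟨t, ht⟩ : ∃ t : ℝ, fderiv ℝ r x (u + t • v) < 0 := by
      refine ⟨(-fderiv ℝ r x u - 1) / fderiv ℝ r x v, ?_⟩
      rw [map_add, map_smul, smul_eq_mul, div_mul_cancel₀ _ hv.ne]
      linarith
    have h1 := Submodule.subset_span (R := ℝ) (cone _ ht)
    have h2 := Submodule.smul_mem _ t (Submodule.subset_span (R := ℝ) (cone _ hv))
    simpa using Submodule.sub_mem _ h1 h2
  rw [htop]
  exact dense_univ

/-- The compact subsets of the open set `U` with smooth boundary. -/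
structure SmoothCompacts (U : TopologicalSpace.Opens E) where
  carrier : Set E
  isCompact : IsCompact carrier
  smoothBoundary : HasSmoothBoundary carrier
  subset : carrier ⊆ U

/-! ### The spaces on compact sets -/

/-- The Banach space `𝓔_ρ^M(K, F) = {f ∈ C^∞(K, F) : ‖f‖_{K,ρ}^M < ∞}`. -/
def stepSpace (F : Type*) [NormedAddCommGroup F] [NormedSpace ℝ F]
    {U : TopologicalSpace.Opens E} (K : SmoothCompacts U) (M : ℕ → ℝ) (ρ : ℝ) :
    Submodule ℝ (E → F) where
  carrier := {f | f ∈ smoothFunctions F K.carrier ∧ ultraENorm K.carrier K.carrier M ρ f < ⊤}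
  add_mem' := fun {f g} hf hg => ⟨add_mem hf.1 hg.1,
    (ultraENorm_add_le K.smoothBoundary.uniqueDiffOn subset_rfl M ρ hf.1 hg.1).trans_lt
      (ENNReal.add_lt_top.mpr ⟨hf.2, hg.2⟩)⟩
  zero_mem' := ⟨zero_mem _, by rw [ultraENorm_zero]; exact ENNReal.zero_lt_top⟩
  smul_mem' := fun c f hf => ⟨Submodule.smul_mem _ c hf.1, by
    rw [ultraENorm_smul K.smoothBoundary.uniqueDiffOn subset_rfl M ρ c hf.1]
    exact ENNReal.mul_lt_top enorm_lt_top hf.2⟩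

/-- The norm of `𝓔_ρ^M(K, F)`. -/
noncomputable def stepNorm (F : Type*) [NormedAddCommGroup F] [NormedSpace ℝ F]
    {U : TopologicalSpace.Opens E} (K : SmoothCompacts U) (M : ℕ → ℝ) (ρ : ℝ) :
    Seminorm ℝ (stepSpace F K M ρ) :=
  Seminorm.of (fun f => (ultraENorm K.carrier K.carrier M ρ (f : E → F)).toReal)
    (fun f g => by
      rw [← ENNReal.toReal_add f.2.2.ne g.2.2.ne]
      exact ENNReal.toReal_mono (ENNReal.add_lt_top.mpr ⟨f.2.2, g.2.2⟩).ne
        (ultraENorm_add_le K.smoothBoundary.uniqueDiffOn subset_rfl M ρ f.2.1 g.2.1))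
    (fun c f => by
      rw [Submodule.coe_smul,
        ultraENorm_smul K.smoothBoundary.uniqueDiffOn subset_rfl M ρ c f.2.1, ENNReal.toReal_mul,
        toReal_enorm])

/-- The norm topology of `𝓔_ρ^M(K, F)`. -/
noncomputable def stepTopology (F : Type*) [NormedAddCommGroup F] [NormedSpace ℝ F]
    {U : TopologicalSpace.Opens E} (K : SmoothCompacts U) (M : ℕ → ℝ) (ρ : ℝ) :
    TopologicalSpace (stepSpace F K M ρ) :=
  (stepNorm F K M ρ).toAddGroupSeminorm.toSeminormedAddCommGroup.toPseudoMetricSpace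
    |>.toUniformSpace.toTopologicalSpace

variable {Λ : Set ℝ}

/-- `𝓔^{𝔐}(K, F) = ⋃_{λ, ρ} 𝓔_ρ^{M^λ}(K, F)`, the Roumieu space on the compact set `K`. -/
def roumieuCompact (F : Type*) [NormedAddCommGroup F] [NormedSpace ℝ F]
    {U : TopologicalSpace.Opens E} (𝔐 : WeightMatrix Λ) (K : SmoothCompacts U) :
    Submodule ℝ (E → F) where
  carrier := {f | ∃ l, ∃ ρ > 0, f ∈ stepSpace F K (𝔐.seq l) ρ}
  add_mem' := by
    rintro f g ⟨l, ρ, hρ, hf⟩ ⟨m, σ, hσ, hg⟩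
    refine ⟨max l m, max ρ σ, lt_max_of_lt_left hρ, add_mem ⟨hf.1, ?_⟩ ⟨hg.1, ?_⟩⟩
    · exact (ultraENorm_anti _ _ (𝔐.pos l) (𝔐.mono _ _ (le_max_left l m)) hρ
        (le_max_left ρ σ) f).trans_lt hf.2
    · exact (ultraENorm_anti _ _ (𝔐.pos m) (𝔐.mono _ _ (le_max_right l m)) hσ
        (le_max_right ρ σ) g).trans_lt hg.2
  zero_mem' := ⟨⟨_, 𝔐.nonempty.some_mem⟩, 1, one_pos, zero_mem _⟩
  smul_mem' := by
    rintro c f ⟨l, ρ, hρ, hf⟩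
    exact ⟨l, ρ, hρ, Submodule.smul_mem _ c hf⟩

theorem stepSpace_le_roumieuCompact {U : TopologicalSpace.Opens E} (𝔐 : WeightMatrix Λ)
    (K : SmoothCompacts U) (l : Λ) {ρ : ℝ} (hρ : 0 < ρ) :
    stepSpace F K (𝔐.seq l) ρ ≤ roumieuCompact F 𝔐 K :=
  fun _ hf => ⟨l, ρ, hρ, hf⟩

/-- The topology of `𝓔^{𝔐}(K, F)`: the locally convex inductive limit of the Banach spaces
`𝓔_ρ^{M^λ}(K, F)`, i.e. the finest locally convex vector space topology for which the inclusions of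
all these spaces are continuous (`sInf` of topologies is the supremum in the order of fineness). -/
noncomputable def roumieuCompactTopology (F : Type*) [NormedAddCommGroup F] [NormedSpace ℝ F]
    {U : TopologicalSpace.Opens E} (𝔐 : WeightMatrix Λ) (K : SmoothCompacts U) :
    TopologicalSpace (roumieuCompact F 𝔐 K) :=
  sInf {t | @IsTopologicalAddGroup (roumieuCompact F 𝔐 K) t _ ∧
    @ContinuousSMul ℝ (roumieuCompact F 𝔐 K) _ _ t ∧
    @LocallyConvexSpace ℝ (roumieuCompact F 𝔐 K) _ _ _ _ t ∧
    ∀ (l : Λ) (ρ : ℝ) (hρ : 0 < ρ), Continuous[stepTopology F K (𝔐.seq l) ρ, t]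
      (Submodule.inclusion (stepSpace_le_roumieuCompact 𝔐 K l hρ))}

/-! ### The spaces on open sets -/

/-- The Beurling space `𝓔^(𝔐)(U, F)`: all `f ∈ C^∞(U, F)` with `‖f‖_{K,ρ}^{M^λ} < ∞` for all `λ`,
all compact `K ⊆ U` and all `ρ > 0`. -/
def beurlingSpace (F : Type*) [NormedAddCommGroup F] [NormedSpace ℝ F]
    (𝔐 : WeightMatrix Λ) (U : TopologicalSpace.Opens E) : Submodule ℝ (E → F) where
  carrier := {f | f ∈ smoothFunctions F (U : Set E) ∧ ∀ l, ∀ K : Set E, IsCompact K → K ⊆ U →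
    ∀ ρ > 0, ultraENorm U K (𝔐.seq l) ρ f < ⊤}
  add_mem' := fun {f g} hf hg => ⟨add_mem hf.1 hg.1, fun l K hK hKU ρ hρ =>
    (ultraENorm_add_le U.isOpen.uniqueDiffOn hKU _ ρ hf.1 hg.1).trans_lt
      (ENNReal.add_lt_top.mpr ⟨hf.2 l K hK hKU ρ hρ, hg.2 l K hK hKU ρ hρ⟩)⟩
  zero_mem' := ⟨zero_mem _, fun l K hK hKU ρ hρ => by
    rw [ultraENorm_zero]; exact ENNReal.zero_lt_top⟩
  smul_mem' := fun c f hf => ⟨Submodule.smul_mem _ c hf.1, fun l K hK hKU ρ hρ => by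
    rw [ultraENorm_smul U.isOpen.uniqueDiffOn hKU _ ρ c hf.1]
    exact ENNReal.mul_lt_top enorm_lt_top (hf.2 l K hK hKU ρ hρ)⟩

/-- The Roumieu space `𝓔^{𝔐}(U, F)`: all `f ∈ C^∞(U, F)` such that for all compact `K ⊆ U` there
are `λ` and `ρ > 0` with `‖f‖_{K,ρ}^{M^λ} < ∞`. -/
def roumieuSpace (F : Type*) [NormedAddCommGroup F] [NormedSpace ℝ F]
    (𝔐 : WeightMatrix Λ) (U : TopologicalSpace.Opens E) : Submodule ℝ (E → F) where
  carrier := {f | f ∈ smoothFunctions F (U : Set E) ∧ ∀ K : Set E, IsCompact K → K ⊆ U →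
    ∃ l, ∃ ρ > 0, ultraENorm U K (𝔐.seq l) ρ f < ⊤}
  add_mem' := by
    refine fun {f g} hf hg => ⟨add_mem hf.1 hg.1, fun K hK hKU => ?_⟩
    obtain ⟨l, ρ, hρ, hf'⟩ := hf.2 K hK hKU
    obtain ⟨m, σ, hσ, hg'⟩ := hg.2 K hK hKU
    refine ⟨max l m, max ρ σ, lt_max_of_lt_left hρ,
      (ultraENorm_add_le U.isOpen.uniqueDiffOn hKU _ _ hf.1 hg.1).trans_lt
        (ENNReal.add_lt_top.mpr ⟨?_, ?_⟩)⟩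
    · exact (ultraENorm_anti _ _ (𝔐.pos l) (𝔐.mono _ _ (le_max_left l m)) hρ
        (le_max_left ρ σ) f).trans_lt hf'
    · exact (ultraENorm_anti _ _ (𝔐.pos m) (𝔐.mono _ _ (le_max_right l m)) hσ
        (le_max_right ρ σ) g).trans_lt hg'
  zero_mem' := ⟨zero_mem _, fun K hK hKU => ⟨⟨_, 𝔐.nonempty.some_mem⟩, 1, one_pos, by
    rw [ultraENorm_zero]; exact ENNReal.zero_lt_top⟩⟩
  smul_mem' := by
    refine fun c f hf => ⟨Submodule.smul_mem _ c hf.1, fun K hK hKU => ?_⟩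
    obtain ⟨l, ρ, hρ, hf'⟩ := hf.2 K hK hKU
    refine ⟨l, ρ, hρ, ?_⟩
    rw [ultraENorm_smul U.isOpen.uniqueDiffOn hKU _ ρ c hf.1]
    exact ENNReal.mul_lt_top enorm_lt_top hf'

/-- The restriction map `𝓔^(𝔐)(U, F) → 𝓔_ρ^{M^λ}(K, F)`. -/
noncomputable def beurlingRestrict {U : TopologicalSpace.Opens E} (𝔐 : WeightMatrix Λ)
    (K : SmoothCompacts U) (l : Λ) {ρ : ℝ} (hρ : 0 < ρ) (f : beurlingSpace F 𝔐 U) :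
    stepSpace F K (𝔐.seq l) ρ :=
  ⟨K.carrier.indicator (f : E → F), indicator_mem_smoothFunctions K.subset f.2.1, by
    rw [ultraENorm_indicator U.isOpen.uniqueDiffOn K.smoothBoundary.uniqueDiffOn K.subset _ ρ
      f.2.1]
    exact f.2.2 l K.carrier K.isCompact K.subset ρ hρ⟩

/-- The restriction map `𝓔^{𝔐}(U, F) → 𝓔^{𝔐}(K, F)`. -/
noncomputable def roumieuRestrict {U : TopologicalSpace.Opens E} (𝔐 : WeightMatrix Λ)
    (K : SmoothCompacts U) (f : roumieuSpace F 𝔐 U) : roumieuCompact F 𝔐 K :=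
  ⟨K.carrier.indicator (f : E → F), by
    obtain ⟨l, ρ, hρ, hf⟩ := f.2.2 K.carrier K.isCompact K.subset
    refine ⟨l, ρ, hρ, indicator_mem_smoothFunctions K.subset f.2.1, ?_⟩
    rwa [ultraENorm_indicator U.isOpen.uniqueDiffOn K.smoothBoundary.uniqueDiffOn K.subset _ ρ
      f.2.1]⟩

/-- The topology of `𝓔^(𝔐)(U, F)`: the projective limit, over `λ`, over the compact sets `K ⊆ U`
with smooth boundary and over `ρ > 0`, of the Banach spaces `𝓔_ρ^{M^λ}(K, F)`. -/
noncomputable def beurlingTopology (F : Type*) [NormedAddCommGroup F] [NormedSpace ℝ F]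
    (𝔐 : WeightMatrix Λ) (U : TopologicalSpace.Opens E) :
    TopologicalSpace (beurlingSpace F 𝔐 U) :=
  ⨅ (l : Λ) (K : SmoothCompacts U) (ρ : ℝ) (hρ : 0 < ρ),
    (stepTopology F K (𝔐.seq l) ρ).induced (beurlingRestrict 𝔐 K l hρ)

/-- The topology of `𝓔^{𝔐}(U, F)`: the projective limit, over the compact sets `K ⊆ U` with smooth
boundary, of the spaces `𝓔^{𝔐}(K, F)`. -/
noncomputable def roumieuTopology (F : Type*) [NormedAddCommGroup F] [NormedSpace ℝ F]
    (𝔐 : WeightMatrix Λ) (U : TopologicalSpace.Opens E) :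
    TopologicalSpace (roumieuSpace F 𝔐 U) :=
  ⨅ K : SmoothCompacts U, (roumieuCompactTopology F 𝔐 K).induced (roumieuRestrict 𝔐 K)

end Spaces

/-! ### Classes of functions and inclusions between them -/

/-- A class of mappings: for every open `U ⊆ E` a topologized space of mappings `U → F`. -/
structure FunctionClass where
  space : ∀ {E : Type} (F : Type) [NormedAddCommGroup E] [NormedSpace ℝ E]
    [NormedAddCommGroup F] [NormedSpace ℝ F] (_ : TopologicalSpace.Opens E), Submodule ℝ (E → F)
  topology : ∀ {E : Type} (F : Type) [NormedAddCommGroup E] [NormedSpace ℝ E]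
    [NormedAddCommGroup F] [NormedSpace ℝ F] (U : TopologicalSpace.Opens E),
    TopologicalSpace (space F U)

/-- The Beurling class `𝓔^(𝔐)`. -/
noncomputable def WeightMatrix.beurling {Λ : Set ℝ} (𝔐 : WeightMatrix Λ) : FunctionClass where
  space F _ _ _ _ U := beurlingSpace F 𝔐 U
  topology F _ _ _ _ U := beurlingTopology F 𝔐 U

/-- The Roumieu class `𝓔^{𝔐}`. -/
noncomputable def WeightMatrix.roumieu {Λ : Set ℝ} (𝔐 : WeightMatrix Λ) : FunctionClass where
  space F _ _ _ _ U := roumieuSpace F 𝔐 U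
  topology F _ _ _ _ U := roumieuTopology F 𝔐 U

namespace FunctionClass

/-- `𝓐(U, F) ⊆ 𝓑(U, F)` with continuous inclusion. -/
def ContinuouslyIncludedOn (A B : FunctionClass) {E : Type} (F : Type) [NormedAddCommGroup E]
    [NormedSpace ℝ E] [NormedAddCommGroup F] [NormedSpace ℝ F]
    (U : TopologicalSpace.Opens E) : Prop :=
  ∃ h : A.space F U ≤ B.space F U,
    Continuous[A.topology F U, B.topology F U] (Submodule.inclusion h)

/-- `𝓐 ⊆ 𝓑`: `𝓐(U, ℝ^m) ⊆ 𝓑(U, ℝ^m)` for all `n, m ≥ 1` and all open `U ⊆ ℝ^n`. -/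
def Included (A B : FunctionClass) : Prop :=
  ∀ n m : ℕ, 0 < n → 0 < m → ∀ U : TopologicalSpace.Opens (EuclideanSpace ℝ (Fin n)),
    A.space (EuclideanSpace ℝ (Fin m)) U ≤ B.space (EuclideanSpace ℝ (Fin m)) U

/-- `𝓐 ⊆ 𝓑` and all the inclusions `𝓐(U, ℝ^m) ⊆ 𝓑(U, ℝ^m)` are continuous. -/
def ContinuouslyIncluded (A B : FunctionClass) : Prop :=
  ∀ n m : ℕ, 0 < n → 0 < m → ∀ U : TopologicalSpace.Opens (EuclideanSpace ℝ (Fin n)),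
    A.ContinuouslyIncludedOn B (EuclideanSpace ℝ (Fin m)) U

/-- `𝓐(ℝ) ⊆ 𝓑(ℝ)`, for real-valued functions on the real line. -/
def IncludedOnReal (A B : FunctionClass) : Prop :=
  A.space ℝ (⊤ : TopologicalSpace.Opens ℝ) ≤ B.space ℝ (⊤ : TopologicalSpace.Opens ℝ)

/-- `𝓐(ℝ) ⊆ 𝓑(ℝ)` with continuous inclusion. -/
def ContinuouslyIncludedOnReal (A B : FunctionClass) : Prop :=
  A.ContinuouslyIncludedOn B ℝ (⊤ : TopologicalSpace.Opens ℝ)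

end FunctionClass

/-! Sufficiency is a comparison of norms: `M k ≤ C * τ ^ k * N k` gives `‖f‖^N_{K,τρ} ≤ C
‖f‖^M_{K,ρ}` (`ultraENorm_le_mul`), with `C` and `τ` independent of `f` and `K`. The same estimate
yields the inclusion of sets and the continuity of the inclusions of step spaces; the universal
properties of the projective and inductive limits then carry continuity to the classes.

Necessity only needs functions on the real line and their derivatives at the origin. Log-convexity
of `W k = k! M k` says that each `n` has a geometric sequence `k ↦ c b^k` lying below `W` and
touching it at `n`. Such a sequence is realized by `c (cos bx + sin bx)`, whose `k`-th derivative at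
`0` is `± c b^k` with a sign depending on `k` only. Sums of these functions therefore have no
cancellation at `0`.

For a Roumieu source, summing all tangents of one `M^λ` with weights `2^{-j}` gives a function whose
derivatives at `0` dominate `2^{-k} k! M^λ_k` (`exists_mem_roumieuSpace`). Its membership in the
target class is the desired domination.

For a Beurling source, a gliding hump is used (`exists_mem_beurlingSpace`). If domination fails
along a sequence of indices going to the bottom of `Λ`, pick for each `n` an order where it fails
badly, take the tangent of `M^{μ n}` there, and shrink its frequency by `n + 1`. The sum lies in the
Beurling class, but its derivatives at `0` escape every bound offered by the target. -/

/-! ### Topologies defined by a single seminorm. -/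

section SeminormTopology

variable {V W : Type*} [AddCommGroup V] [Module ℝ V] [AddCommGroup W] [Module ℝ W]

theorem Seminorm.continuous_of_bound (p : Seminorm ℝ V) (q : Seminorm ℝ W) (L : V →ₗ[ℝ] W) (C : ℝ)
    (h : ∀ v, q (L v) ≤ C * p v) :
    Continuous[p.toAddGroupSeminorm.toSeminormedAddCommGroup.toPseudoMetricSpace
      |>.toUniformSpace.toTopologicalSpace,
      q.toAddGroupSeminorm.toSeminormedAddCommGroup.toPseudoMetricSpace
      |>.toUniformSpace.toTopologicalSpace] L := by
  let := p.toAddGroupSeminorm.toSeminormedAddCommGroup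
  let := q.toAddGroupSeminorm.toSeminormedAddCommGroup
  exact AddMonoidHomClass.continuous_of_bound L C h

theorem Seminorm.topology_locallyConvex (p : Seminorm ℝ V) (t : TopologicalSpace V)
    (ht : t = (p.toAddGroupSeminorm.toSeminormedAddCommGroup.toPseudoMetricSpace
      |>.toUniformSpace.toTopologicalSpace)) :
    IsTopologicalAddGroup V ∧ ContinuousSMul ℝ V ∧ LocallyConvexSpace ℝ V := by
  subst ht
  let : SeminormedAddCommGroup V := p.toAddGroupSeminorm.toSeminormedAddCommGroup
  let : NormedSpace ℝ V := { norm_smul_le := fun c f => (map_smul_eq_mul p c f).le }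
  exact ⟨inferInstanceAs (IsTopologicalAddGroup V), inferInstanceAs (ContinuousSMul ℝ V),
    inferInstanceAs (LocallyConvexSpace ℝ V)⟩

end SeminormTopology

/-! ### Domination of weights implies continuous inclusion. -/

section Comparison

variable {E F : Type*} [NormedAddCommGroup E] [NormedSpace ℝ E]
  [NormedAddCommGroup F] [NormedSpace ℝ F] {Λ : Set ℝ}

theorem factorial_mul_pow_mul_pos {M : ℕ → ℝ} (hM : ∀ k, 0 < M k) {ρ : ℝ} (hρ : 0 < ρ) (k : ℕ) :
    0 < (k ! : ℝ) * ρ ^ k * M k := by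
  have := hM k
  positivity

/-- Finiteness of the extended norm as a real estimate. -/
theorem ultraENorm_lt_top_iff {S K : Set E} {M : ℕ → ℝ} (hM : ∀ k, 0 < M k) {ρ : ℝ} (hρ : 0 < ρ)
    {f : E → F} : ultraENorm S K M ρ f < ⊤ ↔ ∃ C : ℝ, ∀ x ∈ K, ∀ k : ℕ,
      ‖iteratedFDerivWithin ℝ k f S x‖ ≤ C * ((k ! : ℝ) * ρ ^ k * M k) := by
  constructor
  · intro h
    refine ⟨(ultraENorm S K M ρ f).toReal, fun x hx k => ?_⟩
    have hp := factorial_mul_pow_mul_pos hM hρ k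
    have h1 : ‖iteratedFDerivWithin ℝ k f S x‖ₑ / ENNReal.ofReal ((k ! : ℝ) * ρ ^ k * M k) ≤
        ultraENorm S K M ρ f :=
      (le_iSup (fun k : ℕ => ‖iteratedFDerivWithin ℝ k f S x‖ₑ /
        ENNReal.ofReal ((k ! : ℝ) * ρ ^ k * M k)) k).trans (le_iSup₂_of_le x hx le_rfl)
    have h2 := ENNReal.toReal_mono h.ne h1
    rwa [ENNReal.toReal_div, toReal_enorm, ENNReal.toReal_ofReal hp.le, div_le_iff₀ hp] at h2
  · rintro ⟨C, hC⟩
    refine lt_of_le_of_lt (iSup₂_le fun x hx => iSup_le fun k => ?_)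
      (ENNReal.ofReal_lt_top (r := C))
    have hp := factorial_mul_pow_mul_pos hM hρ k
    rw [← ofReal_norm, ← ENNReal.ofReal_div_of_pos hp]
    exact ENNReal.ofReal_le_ofReal ((div_le_iff₀ hp).mpr (hC x hx k))

theorem ultraENorm_le_mul (S K : Set E) {M N : ℕ → ℝ} (hM : ∀ k, 0 < M k) {C τ ρ : ℝ} (hC : 0 < C)
    (hτ : 0 < τ) (h : ∀ k, M k ≤ C * τ ^ k * N k) (hρ : 0 < ρ) (f : E → F) :
    ultraENorm S K N (τ * ρ) f ≤ ENNReal.ofReal C * ultraENorm S K M ρ f := by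
  simp only [ultraENorm, ENNReal.mul_iSup]
  refine iSup₂_mono fun x _ => iSup_mono fun k => ?_
  have hp := factorial_mul_pow_mul_pos hM hρ k
  -- Positivity of `N` is inherited from `M` through the domination.
  have hN : 0 < N k := by
    have := (hM k).trans_le (h k)
    exact pos_of_mul_pos_right this (by positivity)
  rw [← ofReal_norm, ← ENNReal.ofReal_div_of_pos hp, ← ENNReal.ofReal_div_of_pos (by positivity),
    ← ENNReal.ofReal_mul hC.le]
  refine ENNReal.ofReal_le_ofReal ?_
  rw [← mul_div_assoc, div_le_div_iff₀ (by positivity) hp]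
  calc ‖iteratedFDerivWithin ℝ k f S x‖ * ((k ! : ℝ) * ρ ^ k * M k)
      ≤ ‖iteratedFDerivWithin ℝ k f S x‖ * ((k ! : ℝ) * ρ ^ k * (C * τ ^ k * N k)) := by
        have := h k
        gcongr
    _ = _ := by rw [mul_pow]; ring

section Step

variable {U : TopologicalSpace.Opens E} (K : SmoothCompacts U)

theorem stepSpace_mono {M N : ℕ → ℝ} {ρ σ C : ℝ}
    (h : ∀ f : E → F, ultraENorm K.carrier K.carrier N σ f ≤
      ENNReal.ofReal C * ultraENorm K.carrier K.carrier M ρ f) :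
    stepSpace F K M ρ ≤ stepSpace F K N σ :=
  fun f hf => ⟨hf.1, (h f).trans_lt (ENNReal.mul_lt_top ENNReal.ofReal_lt_top hf.2)⟩

theorem stepNorm_apply (M : ℕ → ℝ) (ρ : ℝ) (f : stepSpace F K M ρ) :
    stepNorm F K M ρ f = (ultraENorm K.carrier K.carrier M ρ (f : E → F)).toReal :=
  rfl

theorem stepNorm_inclusion_le {M N : ℕ → ℝ} {ρ σ C : ℝ} (hC : 0 ≤ C)
    (h : ∀ f : E → F, ultraENorm K.carrier K.carrier N σ f ≤
      ENNReal.ofReal C * ultraENorm K.carrier K.carrier M ρ f) (f : stepSpace F K M ρ) :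
    stepNorm F K N σ (Submodule.inclusion (stepSpace_mono K h) f) ≤ C * stepNorm F K M ρ f := by
  rw [stepNorm_apply, stepNorm_apply, Submodule.coe_inclusion]
  have := ENNReal.toReal_mono (ENNReal.mul_lt_top ENNReal.ofReal_lt_top f.2.2).ne (h f)
  rwa [ENNReal.toReal_mul, ENNReal.toReal_ofReal hC] at this

theorem continuous_stepSpace_inclusion {M N : ℕ → ℝ} {ρ σ C : ℝ} (hC : 0 ≤ C)
    (h : ∀ f : E → F, ultraENorm K.carrier K.carrier N σ f ≤
      ENNReal.ofReal C * ultraENorm K.carrier K.carrier M ρ f) :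
    Continuous[stepTopology F K M ρ, stepTopology F K N σ]
      (Submodule.inclusion (stepSpace_mono K h)) := by
  rw [stepTopology, stepTopology]
  exact Seminorm.continuous_of_bound _ _ _ C (stepNorm_inclusion_le K hC h)

theorem stepTopology_locallyConvex (M : ℕ → ℝ) (ρ : ℝ) :
    @IsTopologicalAddGroup (stepSpace F K M ρ) (stepTopology F K M ρ) _ ∧
    @ContinuousSMul ℝ (stepSpace F K M ρ) _ _ (stepTopology F K M ρ) ∧
    @LocallyConvexSpace ℝ (stepSpace F K M ρ) _ _ _ _ (stepTopology F K M ρ) :=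
  Seminorm.topology_locallyConvex (stepNorm F K M ρ) _ rfl

theorem continuous_stepSpace_roumieuCompact (𝔐 : WeightMatrix Λ) (l : Λ) {ρ : ℝ} (hρ : 0 < ρ) :
    Continuous[stepTopology F K (𝔐.seq l) ρ, roumieuCompactTopology F 𝔐 K]
      (Submodule.inclusion (stepSpace_le_roumieuCompact 𝔐 K l hρ)) :=
  continuous_sInf_rng.mpr fun _ ht => ht.2.2.2 l ρ hρ

/-- Universal property of the locally convex inductive limit. -/
theorem continuous_of_roumieuCompact (𝔐 : WeightMatrix Λ) {G : Type*} [AddCommGroup G] [Module ℝ G]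
    (t : TopologicalSpace G) (h1 : IsTopologicalAddGroup G) (h2 : ContinuousSMul ℝ G)
    (h3 : LocallyConvexSpace ℝ G) (L : roumieuCompact F 𝔐 K →ₗ[ℝ] G)
    (hL : ∀ (l : Λ) (ρ : ℝ) (hρ : 0 < ρ), Continuous[stepTopology F K (𝔐.seq l) ρ, t]
      (fun f => L (Submodule.inclusion (stepSpace_le_roumieuCompact 𝔐 K l hρ) f))) :
    Continuous[roumieuCompactTopology F 𝔐 K, t] L := by
  -- The topology pulled back along `L` is itself one of the competitors in the infimum defining the
  -- inductive limit.
  refine continuous_iff_le_induced.mpr (sInf_le ⟨topologicalAddGroup_induced L,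
    continuousSMul_induced L, LocallyConvexSpace.induced L, fun l ρ hρ => ?_⟩)
  exact continuous_induced_rng.mpr (hL l ρ hρ)

end Step

variable {𝔐 𝔑 : WeightMatrix Λ} (F) (U : TopologicalSpace.Opens E)

theorem continuous_beurlingRestrict (𝔐 : WeightMatrix Λ) (K : SmoothCompacts U) (l : Λ) {ρ : ℝ}
    (hρ : 0 < ρ) : Continuous[beurlingTopology F 𝔐 U, stepTopology F K (𝔐.seq l) ρ]
      (beurlingRestrict 𝔐 K l hρ) := by
  refine continuous_iff_le_induced.mpr ?_
  exact (iInf_le _ l).trans ((iInf_le _ K).trans ((iInf_le _ ρ).trans (iInf_le _ hρ)))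

theorem continuous_roumieuRestrict (𝔐 : WeightMatrix Λ) (K : SmoothCompacts U) :
    Continuous[roumieuTopology F 𝔐 U, roumieuCompactTopology F 𝔐 K] (roumieuRestrict 𝔐 K) :=
  continuous_iff_le_induced.mpr (iInf_le _ K)

theorem coe_beurlingRestrict (𝔐 : WeightMatrix Λ) (K : SmoothCompacts U) (l : Λ) {ρ : ℝ}
    (hρ : 0 < ρ) (f : beurlingSpace F 𝔐 U) :
    (beurlingRestrict 𝔐 K l hρ f : E → F) = K.carrier.indicator (f : E → F) :=
  rfl

theorem coe_roumieuRestrict (𝔐 : WeightMatrix Λ) (K : SmoothCompacts U) (f : roumieuSpace F 𝔐 U) :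
    (roumieuRestrict 𝔐 K f : E → F) = K.carrier.indicator (f : E → F) :=
  rfl

theorem continuous_to_beurlingSpace {X : Type*} {t : TopologicalSpace X}
    {g : X → beurlingSpace F 𝔑 U}
    (h : ∀ (l : Λ) (K : SmoothCompacts U) (ρ : ℝ) (hρ : 0 < ρ),
      Continuous[t, stepTopology F K (𝔑.seq l) ρ] (fun x => beurlingRestrict 𝔑 K l hρ (g x))) :
    Continuous[t, beurlingTopology F 𝔑 U] g :=
  continuous_iInf_rng.mpr fun l => continuous_iInf_rng.mpr fun K => continuous_iInf_rng.mpr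
    fun ρ => continuous_iInf_rng.mpr fun hρ => continuous_induced_rng.mpr (h l K ρ hρ)

theorem continuous_to_roumieuSpace {X : Type*} {t : TopologicalSpace X}
    {g : X → roumieuSpace F 𝔑 U}
    (h : ∀ K : SmoothCompacts U,
      Continuous[t, roumieuCompactTopology F 𝔑 K] (fun x => roumieuRestrict 𝔑 K (g x))) :
    Continuous[t, roumieuTopology F 𝔑 U] g :=
  continuous_iInf_rng.mpr fun K => continuous_induced_rng.mpr (h K)

theorem exists_beurling_le_beurling (h : 𝔐.BeurlingDominated 𝔑) :
    ∃ hle : beurlingSpace F 𝔐 U ≤ beurlingSpace F 𝔑 U,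
      Continuous[beurlingTopology F 𝔐 U, beurlingTopology F 𝔑 U] (Submodule.inclusion hle) := by
  -- The constants are fixed before `S`, `K`, `f`: with `S = U` the bound gives membership, with `S
  -- = K` continuity on step spaces.
  have key : ∀ l, ∀ ρ > 0, ∃ m, ∃ σ > 0, ∃ C > 0, ∀ (S K : Set E) (f : E → F),
      ultraENorm S K (𝔑.seq l) ρ f ≤ ENNReal.ofReal C * ultraENorm S K (𝔐.seq m) σ f := by
    intro l ρ hρ
    obtain ⟨m, C, hC, τ, hτ, hm⟩ := h l
    refine ⟨m, ρ / τ, by positivity, C, hC, fun S K f => ?_⟩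
    have := ultraENorm_le_mul S K (𝔐.pos m) hC hτ hm (ρ := ρ / τ) (by positivity) f
    rwa [mul_div_cancel₀ _ hτ.ne'] at this
  have hle : beurlingSpace F 𝔐 U ≤ beurlingSpace F 𝔑 U := by
    refine fun f hf => ⟨hf.1, fun l K hK hKU ρ hρ => ?_⟩
    obtain ⟨m, σ, hσ, C, hC, hm⟩ := key l ρ hρ
    exact (hm U K f).trans_lt (ENNReal.mul_lt_top ENNReal.ofReal_lt_top (hf.2 m K hK hKU σ hσ))
  refine ⟨hle, continuous_to_beurlingSpace F U fun l K ρ hρ => ?_⟩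
  obtain ⟨m, σ, hσ, C, hC, hm⟩ := key l ρ hρ
  have hcomp := @Continuous.comp _ _ _ (_) (_) (_) _ _ (continuous_stepSpace_inclusion K hC.le
    (hm K.carrier K.carrier)) (continuous_beurlingRestrict F U 𝔐 K m hσ)
  convert hcomp using 1
  refine funext fun f => Subtype.ext ?_
  rw [Function.comp_apply, Submodule.coe_inclusion, coe_beurlingRestrict, coe_beurlingRestrict,
    Submodule.coe_inclusion]

theorem exists_roumieu_le_roumieu (h : 𝔐.RoumieuDominated 𝔑) :
    ∃ hle : roumieuSpace F 𝔐 U ≤ roumieuSpace F 𝔑 U,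
      Continuous[roumieuTopology F 𝔐 U, roumieuTopology F 𝔑 U] (Submodule.inclusion hle) := by
  have key : ∀ l, ∀ ρ > 0, ∃ m, ∃ σ > 0, ∃ C > 0, ∀ (S K : Set E) (f : E → F),
      ultraENorm S K (𝔑.seq m) σ f ≤ ENNReal.ofReal C * ultraENorm S K (𝔐.seq l) ρ f := by
    intro l ρ hρ
    obtain ⟨m, C, hC, τ, hτ, hm⟩ := h l
    exact ⟨m, τ * ρ, by positivity, C, hC, fun S K f =>
      ultraENorm_le_mul S K (𝔐.pos l) hC hτ hm hρ f⟩
  have hle : roumieuSpace F 𝔐 U ≤ roumieuSpace F 𝔑 U := by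
    refine fun f hf => ⟨hf.1, fun K hK hKU => ?_⟩
    obtain ⟨l, ρ, hρ, hf'⟩ := hf.2 K hK hKU
    obtain ⟨m, σ, hσ, C, hC, hm⟩ := key l ρ hρ
    exact ⟨m, σ, hσ, (hm U K f).trans_lt (ENNReal.mul_lt_top ENNReal.ofReal_lt_top hf')⟩
  refine ⟨hle, continuous_to_roumieuSpace F U fun K => ?_⟩
  have hK : roumieuCompact F 𝔐 K ≤ roumieuCompact F 𝔑 K := by
    rintro f ⟨l, ρ, hρ, hf⟩
    obtain ⟨m, σ, hσ, C, hC, hm⟩ := key l ρ hρ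
    exact ⟨m, σ, hσ, stepSpace_mono K (hm K.carrier K.carrier) hf⟩
  have hc : Continuous[roumieuCompactTopology F 𝔐 K, roumieuCompactTopology F 𝔑 K]
      (Submodule.inclusion hK) := by
    -- Testing against each competing topology `t` on the target avoids having to know that the
    -- infimum itself is locally convex.
    refine continuous_sInf_rng.mpr fun t ht => ?_
    refine continuous_of_roumieuCompact K 𝔐 t ht.1 ht.2.1 ht.2.2.1 (Submodule.inclusion hK)
      fun l ρ hρ => ?_
    obtain ⟨m, σ, hσ, C, hC, hm⟩ := key l ρ hρ
    have hcomp := @Continuous.comp _ _ _ (_) (_) (_) _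
      (Submodule.inclusion (stepSpace_le_roumieuCompact 𝔑 K m hσ)) (ht.2.2.2 m σ hσ)
      (continuous_stepSpace_inclusion K hC.le (hm K.carrier K.carrier))
    convert hcomp using 1
    refine funext fun f => Subtype.ext ?_
    rw [Function.comp_apply, Submodule.coe_inclusion,
      Submodule.coe_inclusion, Submodule.coe_inclusion, Submodule.coe_inclusion]
  have hcomp := @Continuous.comp _ _ _ (_) (_) (_) _ _ hc (continuous_roumieuRestrict F U 𝔐 K)
  convert hcomp using 1
  refine funext fun f => Subtype.ext ?_
  rw [Function.comp_apply, Submodule.coe_inclusion, coe_roumieuRestrict, coe_roumieuRestrict,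
    Submodule.coe_inclusion]

theorem exists_roumieu_le_beurling (h : 𝔐.RoumieuBeurlingDominated 𝔑) :
    ∃ hle : roumieuSpace F 𝔐 U ≤ beurlingSpace F 𝔑 U,
      Continuous[roumieuTopology F 𝔐 U, beurlingTopology F 𝔑 U] (Submodule.inclusion hle) := by
  have key : ∀ l m, ∀ ρ > 0, ∀ σ > 0, ∃ C > 0, ∀ (S K : Set E) (f : E → F),
      ultraENorm S K (𝔑.seq m) σ f ≤ ENNReal.ofReal C * ultraENorm S K (𝔐.seq l) ρ f := by
    intro l m ρ hρ σ hσ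
    have hτ : 0 < σ / ρ := by positivity
    -- Strict domination at rate `σ / ρ` sends any given `ρ` to any prescribed `σ`.
    obtain ⟨C, hC, hm⟩ := h l m _ hτ
    refine ⟨C, hC, fun S K f => ?_⟩
    have := ultraENorm_le_mul S K (𝔐.pos l) hC hτ hm hρ f
    rwa [div_mul_cancel₀ _ hρ.ne'] at this
  have hle : roumieuSpace F 𝔐 U ≤ beurlingSpace F 𝔑 U := by
    refine fun f hf => ⟨hf.1, fun m K hK hKU σ hσ => ?_⟩
    obtain ⟨l, ρ, hρ, hf'⟩ := hf.2 K hK hKU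
    obtain ⟨C, hC, hm⟩ := key l m ρ hρ σ hσ
    exact (hm U K f).trans_lt (ENNReal.mul_lt_top ENNReal.ofReal_lt_top hf')
  refine ⟨hle, continuous_to_beurlingSpace F U fun m K σ hσ => ?_⟩
  have hK : roumieuCompact F 𝔐 K ≤ stepSpace F K (𝔑.seq m) σ := by
    rintro f ⟨l, ρ, hρ, hf⟩
    obtain ⟨C, hC, hm⟩ := key l m ρ hρ σ hσ
    exact stepSpace_mono K (hm K.carrier K.carrier) hf
  -- The universal property of the inductive limit requires a locally convex target, here a single
  -- step space.
  have hlc := stepTopology_locallyConvex (F := F) K (𝔑.seq m) σ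
  have hc : Continuous[roumieuCompactTopology F 𝔐 K, stepTopology F K (𝔑.seq m) σ]
      (Submodule.inclusion hK) := by
    refine continuous_of_roumieuCompact K 𝔐 _ hlc.1 hlc.2.1 hlc.2.2 (Submodule.inclusion hK)
      fun l ρ hρ => ?_
    obtain ⟨C, hC, hm⟩ := key l m ρ hρ σ hσ
    convert continuous_stepSpace_inclusion K hC.le (hm K.carrier K.carrier) using 1
    refine funext fun f => Subtype.ext ?_
    rw [Submodule.coe_inclusion, Submodule.coe_inclusion, Submodule.coe_inclusion]
  have hcomp := @Continuous.comp _ _ _ (_) (_) (_) _ _ hc (continuous_roumieuRestrict F U 𝔐 K)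
  convert hcomp using 1
  refine funext fun f => Subtype.ext ?_
  rw [Function.comp_apply, Submodule.coe_inclusion, coe_beurlingRestrict, coe_roumieuRestrict,
    Submodule.coe_inclusion]

theorem exists_beurling_le_roumieu (h : 𝔐.BeurlingRoumieuDominated 𝔑) :
    ∃ hle : beurlingSpace F 𝔐 U ≤ roumieuSpace F 𝔑 U,
      Continuous[beurlingTopology F 𝔐 U, roumieuTopology F 𝔑 U] (Submodule.inclusion hle) := by
  obtain ⟨l, m, C, hC, τ, hτ, hm⟩ := h
  have key (S K : Set E) (f : E → F) :
      ultraENorm S K (𝔑.seq m) (τ * 1) f ≤ ENNReal.ofReal C * ultraENorm S K (𝔐.seq l) 1 f :=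
    ultraENorm_le_mul S K (𝔐.pos l) hC hτ hm one_pos f
  have hτ1 : 0 < τ * 1 := by positivity
  have hle : beurlingSpace F 𝔐 U ≤ roumieuSpace F 𝔑 U := by
    refine fun f hf => ⟨hf.1, fun K hK hKU => ⟨m, τ * 1, hτ1, ?_⟩⟩
    exact (key U K f).trans_lt
      (ENNReal.mul_lt_top ENNReal.ofReal_lt_top (hf.2 l K hK hKU 1 one_pos))
  refine ⟨hle, continuous_to_roumieuSpace F U fun K => ?_⟩
  have hcomp := @Continuous.comp _ _ _ (_) (_) (_) _ _ (continuous_stepSpace_roumieuCompact K 𝔑 m hτ1)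
    (@Continuous.comp _ _ _ (_) (_) (_) _ _
      (continuous_stepSpace_inclusion K hC.le (key K.carrier K.carrier))
      (continuous_beurlingRestrict F U 𝔐 K l one_pos))
  convert hcomp using 1
  refine funext fun f => Subtype.ext ?_
  rw [Function.comp_apply, Function.comp_apply, Submodule.coe_inclusion, Submodule.coe_inclusion,
    coe_beurlingRestrict, coe_roumieuRestrict, Submodule.coe_inclusion]

end Comparison

/-! ### Invariance under linear isometries, from `ℝ^1` to `ℝ`. -/

section Transport

variable {E E' F F' : Type*} [NormedAddCommGroup E] [NormedSpace ℝ E]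
  [NormedAddCommGroup F] [NormedSpace ℝ F] [NormedAddCommGroup E'] [NormedSpace ℝ E']
  [NormedAddCommGroup F'] [NormedSpace ℝ F'] {Λ : Set ℝ}
  (e : E' ≃ₗᵢ[ℝ] E) (e' : F ≃ₗᵢ[ℝ] F')

theorem mem_smoothFunctions_univ {f : E → F} :
    f ∈ smoothFunctions F (Set.univ : Set E) ↔ ContDiff ℝ ∞ f := by
  refine ⟨fun h => contDiffOn_univ.mp h.1, fun h => ⟨contDiffOn_univ.mpr h, by simp⟩⟩

/-- Composing with linear isometries on either side preserves the operator norm of every derivative.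
-/
theorem ultraENorm_univ_comp (K : Set E') (M : ℕ → ℝ) (ρ : ℝ) (f : E → F) :
    ultraENorm Set.univ K M ρ (e' ∘ f ∘ e) = ultraENorm Set.univ (e '' K) M ρ f := by
  simp only [ultraENorm, iSup_image]
  refine iSup_congr fun x => iSup_congr fun _ => iSup_congr fun k => ?_
  rw [iteratedFDerivWithin_univ, iteratedFDerivWithin_univ, ← ofReal_norm, ← ofReal_norm,
    e'.norm_iteratedFDeriv_comp_left, e.norm_iteratedFDeriv_comp_right]

theorem comp_mem_smoothFunctions_univ {f : E → F} (hf : f ∈ smoothFunctions F (Set.univ : Set E)) :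
    e' ∘ f ∘ e ∈ smoothFunctions F' (Set.univ : Set E') :=
  mem_smoothFunctions_univ.mpr
    (e'.contDiff.comp ((mem_smoothFunctions_univ.mp hf).comp e.contDiff))

theorem comp_mem_beurlingSpace (𝔐 : WeightMatrix Λ) {f : E → F}
    (hf : f ∈ beurlingSpace F 𝔐 (⊤ : TopologicalSpace.Opens E)) :
    e' ∘ f ∘ e ∈ beurlingSpace F' 𝔐 (⊤ : TopologicalSpace.Opens E') := by
  refine ⟨comp_mem_smoothFunctions_univ e e' hf.1, fun l K hK _ ρ hρ => ?_⟩
  exact (ultraENorm_univ_comp e e' K _ ρ f).trans_lt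
    (hf.2 l _ (hK.image e.continuous) (Set.subset_univ _) ρ hρ)

theorem comp_mem_roumieuSpace (𝔐 : WeightMatrix Λ) {f : E → F}
    (hf : f ∈ roumieuSpace F 𝔐 (⊤ : TopologicalSpace.Opens E)) :
    e' ∘ f ∘ e ∈ roumieuSpace F' 𝔐 (⊤ : TopologicalSpace.Opens E') := by
  refine ⟨comp_mem_smoothFunctions_univ e e' hf.1, fun K hK _ => ?_⟩
  obtain ⟨l, ρ, hρ, h⟩ := hf.2 _ (hK.image e.continuous) (Set.subset_univ _)
  exact ⟨l, ρ, hρ, (ultraENorm_univ_comp e e' K _ ρ f).trans_lt h⟩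

/-- Spaces on the whole space are invariant under linear isometries. -/
def FunctionClass.IsometryInvariant (A : FunctionClass) : Prop :=
  ∀ {E E' F F' : Type} [NormedAddCommGroup E] [NormedSpace ℝ E]
    [NormedAddCommGroup F] [NormedSpace ℝ F] [NormedAddCommGroup E'] [NormedSpace ℝ E']
    [NormedAddCommGroup F'] [NormedSpace ℝ F'] (e : E' ≃ₗᵢ[ℝ] E) (e' : F ≃ₗᵢ[ℝ] F') {f : E → F},
    f ∈ A.space F (⊤ : TopologicalSpace.Opens E) →
      e' ∘ f ∘ e ∈ A.space F' (⊤ : TopologicalSpace.Opens E')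

theorem WeightMatrix.beurling_isometryInvariant (𝔐 : WeightMatrix Λ) :
    𝔐.beurling.IsometryInvariant :=
  fun e e' _ hf => comp_mem_beurlingSpace e e' 𝔐 hf

theorem WeightMatrix.roumieu_isometryInvariant (𝔐 : WeightMatrix Λ) :
    𝔐.roumieu.IsometryInvariant :=
  fun e e' _ hf => comp_mem_roumieuSpace e e' 𝔐 hf

theorem FunctionClass.Included.includedOnReal {A B : FunctionClass} (hA : A.IsometryInvariant)
    (hB : B.IsometryInvariant) (h : A.Included B) : A.IncludedOnReal B := by
  intro f hf
  let e : EuclideanSpace ℝ (Fin 1) ≃ₗᵢ[ℝ] ℝ :=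
    (OrthonormalBasis.singleton (Fin 1) ℝ).repr.symm
  have h1 := hB e.symm e (h 1 1 one_pos one_pos ⊤ (hA e e.symm hf))
  convert h1 using 1
  ext x
  simp

end Transport

/-! ### Trigonometric series without cancellation at the origin. -/

section Lacunary

/-- Differentiation maps `(α, β)` to `(β, -α)`. The sum of cosine and sine is used because its
derivatives at `0` never vanish, whereas those of either function alone do for every other order. -/
theorem exists_iteratedDeriv_cos_add_sin (k : ℕ) : ∃ α β : ℝ, |α| = 1 ∧ |β| = 1 ∧
    iteratedDeriv k (fun x => Real.cos x + Real.sin x) =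
      fun x => α * Real.cos x + β * Real.sin x := by
  induction k with
  | zero => exact ⟨1, 1, by simp, by simp, by simp⟩
  | succ k ih =>
    obtain ⟨α, β, hα, hβ, h⟩ := ih
    refine ⟨β, -α, hβ, by rwa [abs_neg], ?_⟩
    rw [iteratedDeriv_succ, h]
    ext x
    have := ((Real.hasDerivAt_cos x).const_mul α).add ((Real.hasDerivAt_sin x).const_mul β)
    refine (this.deriv).trans ?_
    ring

theorem contDiff_cos_add_sin {n : WithTop ℕ∞} :
    ContDiff ℝ n (fun x => Real.cos x + Real.sin x) :=
  Real.contDiff_cos.add Real.contDiff_sin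

/-- The trigonometric series `∑ c_j (cos (b_j x) + sin (b_j x))`. -/
noncomputable def trigSeries (c b : ℕ → ℝ) (x : ℝ) : ℝ :=
  ∑' j, c j * (Real.cos (b j * x) + Real.sin (b j * x))

theorem iteratedDeriv_trigTerm (c b : ℝ) (k : ℕ) (x : ℝ) :
    iteratedDeriv k (fun x => c * (Real.cos (b * x) + Real.sin (b * x))) x =
      c * (b ^ k * iteratedDeriv k (fun x => Real.cos x + Real.sin x) (b * x)) := by
  rw [iteratedDeriv_const_mul_field, iteratedDeriv_comp_const_mul contDiff_cos_add_sin b]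

variable {c b : ℕ → ℝ} (hc : ∀ j, 0 ≤ c j) (hb : ∀ j, 0 ≤ b j)
  (hs : ∀ k : ℕ, Summable fun j => c j * b j ^ k)
include hc hb

theorem norm_iteratedFDeriv_trigTerm_le (k j : ℕ) (x : ℝ) :
    ‖iteratedFDeriv ℝ k (fun x => c j * (Real.cos (b j * x) + Real.sin (b j * x))) x‖ ≤
      2 * (c j * b j ^ k) := by
  obtain ⟨α, β, hα, hβ, h⟩ := exists_iteratedDeriv_cos_add_sin k
  rw [norm_iteratedFDeriv_eq_norm_iteratedDeriv, iteratedDeriv_trigTerm, h, norm_mul, norm_mul,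
    Real.norm_of_nonneg (hc j), norm_pow, Real.norm_of_nonneg (hb j), ← mul_assoc, mul_comm (2 : ℝ)]
  have hcb : 0 ≤ c j * b j ^ k := mul_nonneg (hc j) (pow_nonneg (hb j) k)
  refine mul_le_mul_of_nonneg_left ((norm_add_le _ _).trans ?_) hcb
  simp only [norm_mul, Real.norm_eq_abs, hα, hβ, one_mul]
  linarith [Real.abs_cos_le_one (b j * x), Real.abs_sin_le_one (b j * x)]

include hs

theorem contDiff_trigSeries : ContDiff ℝ ∞ (trigSeries c b) :=
  contDiff_tsum (v := fun k j => 2 * (c j * b j ^ k))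
    (fun _ => contDiff_const.mul (contDiff_cos_add_sin.comp (contDiff_const.mul contDiff_id)))
    (fun k _ => (hs k).mul_left 2) fun k j x _ => norm_iteratedFDeriv_trigTerm_le hc hb k j x

theorem iteratedFDeriv_trigSeries (k : ℕ) (x : ℝ) : iteratedFDeriv ℝ k (trigSeries c b) x =
    ∑' j, iteratedFDeriv ℝ k (fun x => c j * (Real.cos (b j * x) + Real.sin (b j * x))) x :=
  iteratedFDeriv_tsum_apply (v := fun k j => 2 * (c j * b j ^ k)) (N := ⊤)
    (fun _ => contDiff_const.mul (contDiff_cos_add_sin.comp (contDiff_const.mul contDiff_id)))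
    (fun k _ => (hs k).mul_left 2) (fun k j x _ => norm_iteratedFDeriv_trigTerm_le hc hb k j x)
    le_top x

theorem norm_iteratedFDeriv_trigSeries_le (k : ℕ) (x : ℝ) :
    ‖iteratedFDeriv ℝ k (trigSeries c b) x‖ ≤ 2 * ∑' j, c j * b j ^ k := by
  rw [iteratedFDeriv_trigSeries hc hb hs, ← tsum_mul_left]
  exact tsum_of_norm_bounded ((hs k).mul_left 2).hasSum
    fun j => norm_iteratedFDeriv_trigTerm_le hc hb k j x

/-- At `0` every term carries the same factor `α = ±1`, which depends on `k` but not on `j`, so the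
nonnegative terms add up. -/
theorem norm_iteratedFDeriv_trigSeries_zero (k : ℕ) :
    ‖iteratedFDeriv ℝ k (trigSeries c b) 0‖ = ∑' j, c j * b j ^ k := by
  obtain ⟨α, β, hα, hβ, h⟩ := exists_iteratedDeriv_cos_add_sin k
  have hsum : Summable fun j =>
      iteratedFDeriv ℝ k (fun x => c j * (Real.cos (b j * x) + Real.sin (b j * x))) 0 :=
    Summable.of_norm_bounded ((hs k).mul_left 2)
      fun j => norm_iteratedFDeriv_trigTerm_le hc hb k j 0
  have h1 : iteratedDeriv k (trigSeries c b) 0 = ∑' j, (c j * b j ^ k) * α := by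
    rw [iteratedDeriv_eq_iteratedFDeriv, iteratedFDeriv_trigSeries hc hb hs]
    refine (ContinuousMultilinearMap.tsum_eval hsum _).trans (tsum_congr fun j => ?_)
    rw [← iteratedDeriv_eq_iteratedFDeriv, iteratedDeriv_trigTerm, h]
    simp [mul_assoc]
  rw [norm_iteratedFDeriv_eq_norm_iteratedDeriv, h1, tsum_mul_right, norm_mul, Real.norm_eq_abs α,
    hα, mul_one, Real.norm_of_nonneg]
  exact tsum_nonneg fun j => mul_nonneg (hc j) (pow_nonneg (hb j) k)

end Lacunary

/-! ### Log-convex sequences and coinitial sequences of indices. -/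

section Sequences

/-- A log-convex sequence lies above its tangents. -/
theorem mul_ratio_pow_le_of_logConvex {W : ℕ → ℝ} (hW : ∀ k, 0 < W k)
    (hlc : ∀ k, W (k + 1) ^ 2 ≤ W k * W (k + 2)) (n k : ℕ) :
    W n * (W (n + 1) / W n) ^ k ≤ W k * (W (n + 1) / W n) ^ n := by
  -- Consecutive ratios increase, so from `n` upwards `W` grows at least as fast as the geometric
  -- sequence of ratio `W (n + 1) / W n`, and from `n` downwards it decreases at most as fast.
  have hr : Monotone fun k => W (k + 1) / W k := by
    refine monotone_nat_of_le_succ fun k => ?_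
    rw [div_le_div_iff₀ (hW k) (hW (k + 1)), ← sq, mul_comm]
    exact hlc k
  have hstep (k : ℕ) : W (k + 1) = W k * (W (k + 1) / W k) := by
    rw [mul_div_cancel₀ _ (hW k).ne']
  have ha : 0 < W (n + 1) / W n := div_pos (hW _) (hW _)
  rcases le_total n k with h | h
  · induction k, h using Nat.le_induction with
    | base => exact le_rfl
    | succ k hk ih =>
      have h1 : W (n + 1) / W n ≤ W (k + 1) / W k := hr hk
      rw [hstep k, pow_succ, ← mul_assoc, mul_right_comm (W k)]
      exact mul_le_mul ih h1 ha.le (mul_nonneg (hW k).le (pow_nonneg ha.le n))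
  · induction h using Nat.decreasingInduction with
    | self => exact le_rfl
    | of_succ k hk ih =>
      have h1 : W (k + 1) / W k ≤ W (n + 1) / W n := hr hk.le
      refine le_of_mul_le_mul_right ?_ ha
      calc W n * (W (n + 1) / W n) ^ k * (W (n + 1) / W n)
          = W n * (W (n + 1) / W n) ^ (k + 1) := by rw [pow_succ, mul_assoc]
        _ ≤ W (k + 1) * (W (n + 1) / W n) ^ n := ih
        _ = W k * (W (n + 1) / W n) ^ n * (W (k + 1) / W k) := by
          rw [hstep k, mul_right_comm, ← hstep k]
        _ ≤ W k * (W (n + 1) / W n) ^ n * (W (n + 1) / W n) :=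
          mul_le_mul_of_nonneg_left h1 (mul_nonneg (hW k).le (pow_nonneg ha.le n))

theorem exists_pow_le_mul_of_tendsto_root {W : ℕ → ℝ} (hW : ∀ k, 0 < W k)
    (h : Filter.Tendsto (fun k : ℕ => W k ^ (1 / (k : ℝ))) Filter.atTop Filter.atTop) {t : ℝ}
    (ht : 0 ≤ t) : ∃ D, ∀ k, t ^ k ≤ D * W k := by
  have hev : ∀ᶠ k in Filter.atTop, t ^ k / W k ≤ 1 := by
    -- At `k = 0` the exponent `1 / k` takes the default value `0`, and the root would not recover
    -- `W 0`.
    filter_upwards [h.eventually_ge_atTop t, Filter.eventually_gt_atTop 0] with k hk hk0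
    rw [div_le_one (hW k)]
    calc t ^ k ≤ (W k ^ (1 / (k : ℝ))) ^ k := by gcongr
      _ = W k := by
        rw [one_div, Real.rpow_inv_natCast_pow (hW k).le hk0.ne']
  have hbdd : BddAbove (Set.range fun k => t ^ k / W k) :=
    Filter.IsBoundedUnder.bddAbove_range ⟨1, Filter.eventually_map.mpr hev⟩
  obtain ⟨D, hD⟩ := hbdd
  exact ⟨D, fun k => (div_le_iff₀ (hW k)).mp (hD ⟨k, rfl⟩)⟩

/-- Running minima of a dense sequence: when there is no least element, each `Iio a` is open and
nonempty, so the sequence enters it. Only a closed order is required, since the subspace topology of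
`Λ ⊆ ℝ` need not be its order topology. -/
theorem exists_seq_tendsto_atBot_of_separable (α : Type*) [LinearOrder α] [Nonempty α]
    [TopologicalSpace α] [OrderClosedTopology α] [TopologicalSpace.SeparableSpace α] :
    ∃ u : ℕ → α, Filter.Tendsto u Filter.atTop Filter.atBot := by
  by_cases hmin : ∃ m : α, ∀ a, m ≤ a
  · obtain ⟨m, hm⟩ := hmin
    exact ⟨fun _ => m, Filter.tendsto_atBot.mpr fun a => Filter.Eventually.of_forall fun _ => hm a⟩
  push Not at hmin
  let d := TopologicalSpace.denseSeq α
  refine ⟨fun n => (Finset.range (n + 1)).inf' ⟨0, by simp⟩ d, Filter.tendsto_atBot.mpr fun a => ?_⟩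
  obtain ⟨i, hi⟩ := (TopologicalSpace.denseRange_denseSeq α).exists_mem_open isOpen_Iio (hmin a)
  filter_upwards [Filter.eventually_ge_atTop i] with n hn
  exact (Finset.inf'_le d (Finset.mem_range.mpr (Nat.lt_succ_of_le hn))).trans (le_of_lt hi)

end Sequences

/-! ### Tangents to the sequences `k! M_k`. -/

namespace WeightMatrix

variable {Λ : Set ℝ} (𝔐 : WeightMatrix Λ)

include 𝔐 in
theorem exists_seq_tendsto_atBot : ∃ u : ℕ → Λ, Filter.Tendsto u Filter.atTop Filter.atBot :=
  have : Nonempty Λ := 𝔐.nonempty.to_subtype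
  exists_seq_tendsto_atBot_of_separable Λ

include 𝔐 in
theorem exists_seq_tendsto_atTop : ∃ u : ℕ → Λ, Filter.Tendsto u Filter.atTop Filter.atTop :=
  have : Nonempty Λ := 𝔐.nonempty.to_subtype
  exists_seq_tendsto_atBot_of_separable Λᵒᵈ

theorem factorial_mul_seq_pos (l : Λ) (k : ℕ) : 0 < (k ! : ℝ) * 𝔐.seq l k := by
  have := 𝔐.pos l k
  positivity

/-- The slope of the tangent to `(k! M_k)_k` at `n`. -/
noncomputable def ratio (l : Λ) (n : ℕ) : ℝ :=
  (((n + 1)! : ℝ) * 𝔐.seq l (n + 1)) / ((n ! : ℝ) * 𝔐.seq l n)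

theorem ratio_pos (l : Λ) (n : ℕ) : 0 < 𝔐.ratio l n :=
  div_pos (𝔐.factorial_mul_seq_pos l _) (𝔐.factorial_mul_seq_pos l _)

/-- The coefficient for which `(tangentCoeff l n * ratio l n ^ k)_k` is tangent to `(k! M_k)_k`
at `n`. -/
noncomputable def tangentCoeff (l : Λ) (n : ℕ) : ℝ :=
  (n ! : ℝ) * 𝔐.seq l n / 𝔐.ratio l n ^ n

theorem tangentCoeff_pos (l : Λ) (n : ℕ) : 0 < 𝔐.tangentCoeff l n :=
  div_pos (𝔐.factorial_mul_seq_pos l _) (pow_pos (𝔐.ratio_pos l n) n)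

theorem tangentCoeff_mul_ratio_pow_self (l : Λ) (n : ℕ) :
    𝔐.tangentCoeff l n * 𝔐.ratio l n ^ n = (n ! : ℝ) * 𝔐.seq l n :=
  div_mul_cancel₀ _ (pow_pos (𝔐.ratio_pos l n) n).ne'

theorem tangentCoeff_mul_ratio_pow_le (l : Λ) (n k : ℕ) :
    𝔐.tangentCoeff l n * 𝔐.ratio l n ^ k ≤ (k ! : ℝ) * 𝔐.seq l k := by
  rw [tangentCoeff, div_mul_eq_mul_div, div_le_iff₀ (pow_pos (𝔐.ratio_pos l n) n)]
  exact mul_ratio_pow_le_of_logConvex (W := fun k => (k ! : ℝ) * 𝔐.seq l k)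
    (𝔐.factorial_mul_seq_pos l) (𝔐.weaklyLogConvex l) n k

/-- The root condition makes any single exponential, of whatever frequency, admissible for every `l`
and `ρ`. This absorbs the finitely many initial terms of the gliding hump. -/
theorem exists_pow_le_mul (l : Λ) {b ρ : ℝ} (hb : 0 ≤ b) (hρ : 0 < ρ) :
    ∃ D, ∀ k, b ^ k ≤ D * ((k ! : ℝ) * ρ ^ k * 𝔐.seq l k) := by
  obtain ⟨D, hD⟩ := exists_pow_le_mul_of_tendsto_root (𝔐.factorial_mul_seq_pos l)
    (𝔐.tendsto_root l) (div_nonneg hb hρ.le)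
  refine ⟨D, fun k => ?_⟩
  have := hD k
  rw [div_pow, div_le_iff₀ (pow_pos hρ k)] at this
  exact this.trans_eq (by ring)

end WeightMatrix

/-! ### Termwise criteria for trigonometric series. -/

section Membership

variable {c b : ℕ → ℝ} (hc : ∀ j, 0 ≤ c j) (hb : ∀ j, 0 ≤ b j)
include hc hb

theorem summable_trigSeries_coeff {d w : ℕ → ℝ} (hd : Summable d)
    (h : ∀ j k, c j * b j ^ k ≤ d j * w k) (k : ℕ) : Summable fun j => c j * b j ^ k :=
  Summable.of_nonneg_of_le (fun j => mul_nonneg (hc j) (pow_nonneg (hb j) k)) (fun j => h j k)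
    (hd.mul_right _)

theorem ultraENorm_trigSeries_lt_top {d M : ℕ → ℝ} {ρ : ℝ} (hM : ∀ k, 0 < M k) (hρ : 0 < ρ)
    (hd : Summable d) (h : ∀ j k : ℕ, c j * b j ^ k ≤ d j * ((k ! : ℝ) * ρ ^ k * M k))
    (K : Set ℝ) : ultraENorm Set.univ K M ρ (trigSeries c b) < ⊤ := by
  have hs := summable_trigSeries_coeff hc hb hd h
  refine (ultraENorm_lt_top_iff hM hρ).mpr ⟨2 * ∑' j, d j, fun x _ k => ?_⟩
  rw [iteratedFDerivWithin_univ, mul_assoc, ← tsum_mul_right]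
  refine (norm_iteratedFDeriv_trigSeries_le hc hb hs k x).trans ?_
  exact mul_le_mul_of_nonneg_left ((hs k).tsum_le_tsum (fun j => h j k) (hd.mul_right _)) two_pos.le

theorem coeff_le_norm_iteratedFDeriv_trigSeries
    (hs : ∀ k : ℕ, Summable fun j => c j * b j ^ k) (j k : ℕ) :
    c j * b j ^ k ≤ ‖iteratedFDeriv ℝ k (trigSeries c b) 0‖ := by
  rw [norm_iteratedFDeriv_trigSeries_zero hc hb hs]
  exact (hs k).le_tsum j fun i _ => mul_nonneg (hc i) (pow_nonneg (hb i) k)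

end Membership

/-! ### Construction of the test functions. -/

namespace WeightMatrix

variable {Λ : Set ℝ} (𝔐 : WeightMatrix Λ)

/-- Functions of the Roumieu class with maximal growth of the derivatives at the origin. -/
theorem exists_mem_roumieuSpace (l : Λ) :
    ∃ f ∈ roumieuSpace ℝ 𝔐 (⊤ : TopologicalSpace.Opens ℝ),
      ∀ k : ℕ, (1 / 2) ^ k * ((k ! : ℝ) * 𝔐.seq l k) ≤ ‖iteratedFDeriv ℝ k f 0‖ := by
  -- The weight makes the series converge and costs only a factor `2^{-k}` at the contact point `j =
  -- k`, which is harmless up to rescaling `ρ`.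
  let c : ℕ → ℝ := fun j => (1 / 2) ^ j * 𝔐.tangentCoeff l j
  have hc j : 0 ≤ c j := mul_nonneg (by positivity) (𝔐.tangentCoeff_pos l j).le
  have hb j : 0 ≤ 𝔐.ratio l j := (𝔐.ratio_pos l j).le
  have hle (j k : ℕ) :
      c j * 𝔐.ratio l j ^ k ≤ (1 / 2) ^ j * ((k ! : ℝ) * 1 ^ k * 𝔐.seq l k) := by
    rw [one_pow, mul_one, mul_assoc]
    exact mul_le_mul_of_nonneg_left (𝔐.tangentCoeff_mul_ratio_pow_le l j k) (by positivity)
  have hs := summable_trigSeries_coeff hc hb summable_geometric_two hle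
  refine ⟨trigSeries c (𝔐.ratio l), ⟨mem_smoothFunctions_univ.mpr (contDiff_trigSeries hc hb hs),
    fun K _ _ => ⟨l, 1, one_pos, ?_⟩⟩, fun k => ?_⟩
  · exact ultraENorm_trigSeries_lt_top hc hb (𝔐.pos l) one_pos summable_geometric_two hle K
  · refine le_trans (le_of_eq ?_) (coeff_le_norm_iteratedFDeriv_trigSeries hc hb hs k k)
    rw [mul_assoc, tangentCoeff_mul_ratio_pow_self]

/-- Gliding hump: if no `M^{μ n}` is dominated by `P n`, some function of the Beurling class has
derivatives at the origin that are not controlled by the sequences `P n`. -/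
theorem exists_mem_beurlingSpace {μ : ℕ → Λ} (hμ : Filter.Tendsto μ Filter.atTop Filter.atBot)
    {P : ℕ → ℕ → ℝ} (hP : ∀ n, ¬ SeqDominated (𝔐.seq (μ n)) (P n)) :
    ∃ f ∈ beurlingSpace ℝ 𝔐 (⊤ : TopologicalSpace.Opens ℝ), ∀ n : ℕ, ∃ k : ℕ,
      ((n : ℝ) + 1) * ((k ! : ℝ) * ((n : ℝ) + 1) ^ k * P n k) < ‖iteratedFDeriv ℝ k f 0‖ := by
  -- The factor `2 ^ n` pays for the summation weight and one factor `(n + 1) ^ k` for the reduced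
  -- frequency; the remaining `(n + 1) * (n + 1) ^ k` is the surplus claimed.
  have hex (n : ℕ) : ∃ k, 2 ^ n * ((n : ℝ) + 1) * (((n : ℝ) + 1) ^ 2) ^ k * P n k <
      𝔐.seq (μ n) k := by
    by_contra! hcon
    exact hP n ⟨2 ^ n * ((n : ℝ) + 1), by positivity, ((n : ℝ) + 1) ^ 2, by positivity, hcon⟩
  choose κ hκ using hex
  let c : ℕ → ℝ := fun n => (1 / 2) ^ n * 𝔐.tangentCoeff (μ n) (κ n)
  -- Dividing the frequency multiplies the tangent by `(n + 1) ^ (-k)`, which falls below `ρ ^ k`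
  -- for all `k` once `n` is large, whatever `ρ`.
  let b : ℕ → ℝ := fun n => 𝔐.ratio (μ n) (κ n) / ((n : ℝ) + 1)
  have hc n : 0 ≤ c n := mul_nonneg (by positivity) (𝔐.tangentCoeff_pos _ _).le
  have hb n : 0 ≤ b n := div_nonneg (𝔐.ratio_pos _ _).le (by positivity)
  have hcb (n k : ℕ) : c n * b n ^ k = (1 / 2) ^ n * (1 / ((n : ℝ) + 1)) ^ k *
      (𝔐.tangentCoeff (μ n) (κ n) * 𝔐.ratio (μ n) (κ n) ^ k) := by
    simp only [c, b, div_eq_mul_inv, mul_pow]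
    ring
  have hbound (l : Λ) {ρ : ℝ} (hρ : 0 < ρ) : ∃ d : ℕ → ℝ, Summable d ∧
      ∀ n k : ℕ, c n * b n ^ k ≤ d n * ((k ! : ℝ) * ρ ^ k * 𝔐.seq l k) := by
    obtain ⟨N, hN⟩ : ∃ N, ∀ n ≥ N, μ n ≤ l ∧ 1 / ((n : ℝ) + 1) ≤ ρ :=
      Filter.eventually_atTop.mp ((hμ.eventually_le_atBot l).and
        ((tendsto_one_div_add_atTop_nhds_zero_nat (𝕜 := ℝ)).eventually (ge_mem_nhds hρ)))
    choose D hD using fun n => 𝔐.exists_pow_le_mul l (hb n) hρ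
    -- From `N` on, the tangent bound and `μ n ≤ l` give the geometric majorant; the earlier terms
    -- use constants `D n` of no controlled size.
    refine ⟨fun n => if n < N then c n * D n else (1 / 2) ^ n, ?_, fun n k => ?_⟩
    · refine Summable.congr_atTop summable_geometric_two ?_
      filter_upwards [Filter.eventually_ge_atTop N] with n hn
      rw [if_neg hn.not_gt]
    · dsimp only
      split_ifs with hn
      · exact (mul_le_mul_of_nonneg_left (hD n k) (hc n)).trans_eq (mul_assoc _ _ _).symm
      · obtain ⟨h1, h2⟩ := hN n (not_lt.mp hn)
        calc c n * b n ^ k ≤ (1 / 2) ^ n * (1 / ((n : ℝ) + 1)) ^ k *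
              ((k ! : ℝ) * 𝔐.seq (μ n) k) := by
              rw [hcb]
              exact mul_le_mul_of_nonneg_left (𝔐.tangentCoeff_mul_ratio_pow_le _ _ _)
                (by positivity)
          _ ≤ (1 / 2) ^ n * ρ ^ k * ((k ! : ℝ) * 𝔐.seq l k) := by
              have h3 := 𝔐.mono _ _ h1 k
              have h4 := (𝔐.pos (μ n) k).le
              gcongr
          _ = _ := by ring
  obtain ⟨d, hd, hle⟩ := hbound (μ 0) one_pos
  have hs := summable_trigSeries_coeff hc hb hd hle
  refine ⟨trigSeries c b, ⟨mem_smoothFunctions_univ.mpr (contDiff_trigSeries hc hb hs),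
    fun l K _ _ ρ hρ => ?_⟩, fun n => ⟨κ n, ?_⟩⟩
  · obtain ⟨d, hd, hle⟩ := hbound l hρ
    exact ultraENorm_trigSeries_lt_top hc hb (𝔐.pos l) hρ hd hle K
  · refine lt_of_lt_of_le ?_ (coeff_le_norm_iteratedFDeriv_trigSeries hc hb hs n (κ n))
    rw [hcb, tangentCoeff_mul_ratio_pow_self]
    have hn : (0 : ℝ) < (n : ℝ) + 1 := by positivity
    have hpos : (0 : ℝ) < (1 / 2) ^ n * (1 / ((n : ℝ) + 1)) ^ (κ n) * ((κ n)! : ℝ) := by positivity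
    have := mul_lt_mul_of_pos_left (hκ n) hpos
    rw [← mul_assoc]
    rw [← mul_assoc] at this ⊢
    refine lt_of_eq_of_lt ?_ (this.trans_eq (by ring))
    rw [← pow_mul, one_div_pow, one_div_pow]
    field_simp
    ring

end WeightMatrix

/-! ### Inclusion on the real line implies domination. -/

section Necessity

variable {Λ : Set ℝ} {𝔐 𝔑 : WeightMatrix Λ}

theorem norm_iteratedFDeriv_zero_le_of_mem_roumieuSpace {f : ℝ → ℝ}
    (hf : f ∈ roumieuSpace ℝ 𝔐 (⊤ : TopologicalSpace.Opens ℝ)) : ∃ l, ∃ ρ > 0, ∃ C, ∀ k : ℕ,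
      ‖iteratedFDeriv ℝ k f 0‖ ≤ C * ((k ! : ℝ) * ρ ^ k * 𝔐.seq l k) := by
  obtain ⟨l, ρ, hρ, h⟩ := hf.2 {0} isCompact_singleton (Set.subset_univ _)
  obtain ⟨C, hC⟩ := (ultraENorm_lt_top_iff (𝔐.pos l) hρ).mp h
  refine ⟨l, ρ, hρ, C, fun k => ?_⟩
  have := hC 0 rfl k
  rwa [TopologicalSpace.Opens.coe_top, iteratedFDerivWithin_univ] at this

theorem norm_iteratedFDeriv_zero_le_of_mem_beurlingSpace {f : ℝ → ℝ}
    (hf : f ∈ beurlingSpace ℝ 𝔐 (⊤ : TopologicalSpace.Opens ℝ)) (l : Λ) {ρ : ℝ} (hρ : 0 < ρ) :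
    ∃ C, ∀ k : ℕ, ‖iteratedFDeriv ℝ k f 0‖ ≤ C * ((k ! : ℝ) * ρ ^ k * 𝔐.seq l k) := by
  obtain ⟨C, hC⟩ := (ultraENorm_lt_top_iff (𝔐.pos l) hρ).mp
    (hf.2 l {0} isCompact_singleton (Set.subset_univ _) ρ hρ)
  refine ⟨C, fun k => ?_⟩
  have := hC 0 rfl k
  rwa [TopologicalSpace.Opens.coe_top, iteratedFDerivWithin_univ] at this

/-- The doubled rate `2 * ρ` absorbs the loss `2^{-k}` in the lower bound for the Roumieu test
function. -/
theorem exists_le_mul_of_norm_le {M N : ℕ → ℝ} (hN : ∀ k, 0 < N k) {f : ℝ → ℝ} {C ρ : ℝ}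
    (hρ : 0 < ρ) (hM : ∀ k : ℕ, (1 / 2) ^ k * ((k ! : ℝ) * M k) ≤ ‖iteratedFDeriv ℝ k f 0‖)
    (hC : ∀ k : ℕ, ‖iteratedFDeriv ℝ k f 0‖ ≤ C * ((k ! : ℝ) * ρ ^ k * N k)) :
    ∃ C > 0, ∀ k : ℕ, M k ≤ C * (2 * ρ) ^ k * N k := by
  refine ⟨max C 1, by positivity, fun k => ?_⟩
  have hk : (0 : ℝ) < (1 / 2) ^ k * (k ! : ℝ) := by positivity
  refine le_of_mul_le_mul_left ?_ hk
  have hNk := hN k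
  calc (1 / 2) ^ k * (k ! : ℝ) * M k ≤ C * ((k ! : ℝ) * ρ ^ k * N k) := by
        rw [mul_assoc]; exact (hM k).trans (hC k)
    _ ≤ max C 1 * ((k ! : ℝ) * ρ ^ k * N k) := by gcongr; exact le_max_left _ _
    _ = (1 / 2) ^ k * (k ! : ℝ) * (max C 1 * (2 * ρ) ^ k * N k) := by
      rw [mul_pow, one_div_pow]
      field_simp

theorem WeightMatrix.roumieuDominated_of_le
    (h : 𝔐.roumieu.IncludedOnReal 𝔑.roumieu) : 𝔐.RoumieuDominated 𝔑 := by
  intro l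
  obtain ⟨f, hf, hM⟩ := 𝔐.exists_mem_roumieuSpace l
  obtain ⟨m, ρ, hρ, C, hC⟩ := norm_iteratedFDeriv_zero_le_of_mem_roumieuSpace (h hf)
  obtain ⟨C', hC', hle⟩ := exists_le_mul_of_norm_le (𝔑.pos m) hρ hM hC
  exact ⟨m, C', hC', 2 * ρ, by positivity, hle⟩

theorem WeightMatrix.roumieuBeurlingDominated_of_le
    (h : 𝔐.roumieu.IncludedOnReal 𝔑.beurling) : 𝔐.RoumieuBeurlingDominated 𝔑 := by
  intro l m ρ hρ
  obtain ⟨f, hf, hM⟩ := 𝔐.exists_mem_roumieuSpace l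
  -- Half the rate is requested because the comparison of sequences doubles it.
  obtain ⟨C, hC⟩ := norm_iteratedFDeriv_zero_le_of_mem_beurlingSpace (h hf) m (half_pos hρ)
  obtain ⟨C', hC', hle⟩ := exists_le_mul_of_norm_le (𝔑.pos m) (half_pos hρ) hM hC
  rw [mul_div_cancel₀ _ two_ne_zero] at hle
  exact ⟨C', hC', hle⟩

theorem exists_mul_le_of_large {C ρ : ℝ} {n : ℕ} (hρ : 0 < ρ) (hC : C ≤ n) (hn : ρ ≤ n) {x : ℝ}
    (hx : 0 < x) (k : ℕ) :
    C * ((k ! : ℝ) * ρ ^ k * x) ≤ ((n : ℝ) + 1) * ((k ! : ℝ) * ((n : ℝ) + 1) ^ k * x) := by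
  gcongr <;> linarith

theorem WeightMatrix.beurlingDominated_of_le
    (h : 𝔐.beurling.IncludedOnReal 𝔑.beurling) : 𝔐.BeurlingDominated 𝔑 := by
  intro l
  by_contra! hcon
  obtain ⟨μ, hμ⟩ := 𝔐.exists_seq_tendsto_atBot
  obtain ⟨f, hf, hlt⟩ := 𝔐.exists_mem_beurlingSpace hμ (P := fun _ => 𝔑.seq l) fun n => hcon (μ n)
  obtain ⟨C, hC⟩ := norm_iteratedFDeriv_zero_le_of_mem_beurlingSpace (h hf) l one_pos
  obtain ⟨n, hn⟩ := exists_nat_ge (max C 1)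
  obtain ⟨k, hk⟩ := hlt n
  exact absurd (hk.trans_le (hC k)) (exists_mul_le_of_large one_pos ((le_max_left _ _).trans hn)
    ((le_max_right _ _).trans hn) (𝔑.pos l k) k).not_gt

theorem WeightMatrix.beurlingRoumieuDominated_of_le
    (h : 𝔐.beurling.IncludedOnReal 𝔑.roumieu) : 𝔐.BeurlingRoumieuDominated 𝔑 := by
  by_contra hcon
  obtain ⟨μ, hμ⟩ := 𝔐.exists_seq_tendsto_atBot
  obtain ⟨ν, hν⟩ := 𝔐.exists_seq_tendsto_atTop
  -- Letting the target index climb along `ν` defeats all `N^l` with one function, as `N^l ≤ N^{ν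
  -- n}` for large `n`.
  obtain ⟨f, hf, hlt⟩ := 𝔐.exists_mem_beurlingSpace hμ (P := fun n => 𝔑.seq (ν n))
    fun n hn => hcon ⟨μ n, ν n, hn⟩
  obtain ⟨l, ρ, hρ, C, hC⟩ := norm_iteratedFDeriv_zero_le_of_mem_roumieuSpace (h hf)
  obtain ⟨n, hn, hl⟩ := ((tendsto_natCast_atTop_atTop (R := ℝ)).eventually_ge_atTop (max C ρ) |>.and
    (hν.eventually_ge_atTop l)).exists
  obtain ⟨k, hk⟩ := hlt n
  refine absurd (hk.trans_le (hC k)) (le_trans ?_ (exists_mul_le_of_large hρ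
    ((le_max_left _ _).trans hn) ((le_max_right _ _).trans hn) (𝔑.pos (ν n) k) k)).not_gt
  -- The sign of `C`, read off from order `0`, is needed to replace `𝔑.seq l` by the larger `𝔑.seq
  -- (ν n)`.
  have hC0 : 0 ≤ C := by
    have := (norm_nonneg _).trans (hC 0)
    exact nonneg_of_mul_nonneg_left this (factorial_mul_pow_mul_pos (𝔑.pos l) hρ 0)
  have := 𝔑.mono l (ν n) hl k
  gcongr

end Necessity

/-- Sufficiency is assumed for all normed spaces because it serves both the Euclidean spaces and `ℝ`
itself. Continuity comes for free: bare inclusion on `ℝ` already returns `p`. -/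
theorem FunctionClass.tfae_inclusions {A B : FunctionClass}
    {p : Prop} (hA : A.IsometryInvariant) (hB : B.IsometryInvariant)
    (h : p → ∀ {E : Type} (F : Type) [NormedAddCommGroup E] [NormedSpace ℝ E]
      [NormedAddCommGroup F] [NormedSpace ℝ F] (U : TopologicalSpace.Opens E),
      A.ContinuouslyIncludedOn B F U) (h' : A.IncludedOnReal B → p) :
    [p, A.Included B, A.ContinuouslyIncluded B, A.IncludedOnReal B,
      A.ContinuouslyIncludedOnReal B].TFAE := by
  tfae_have 1 → 3 := fun hp n m _ _ U => h hp _ U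
  tfae_have 3 → 2 := fun h3 n m hn hm U => (h3 n m hn hm U).choose
  tfae_have 2 → 4 := fun h2 => h2.includedOnReal hA hB
  tfae_have 4 → 1 := h'
  tfae_have 1 → 5 := fun hp => h hp ℝ ⊤
  tfae_have 5 → 4 := fun h5 => h5.choose
  tfae_finish

theorem proposition4p6 {Λ : Set ℝ} (𝔐 𝔑 : WeightMatrix Λ) :
    -- Beurling into Beurling
    [𝔐.BeurlingDominated 𝔑,
      𝔐.beurling.Included 𝔑.beurling,
      𝔐.beurling.ContinuouslyIncluded 𝔑.beurling,
      𝔐.beurling.IncludedOnReal 𝔑.beurling,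
      𝔐.beurling.ContinuouslyIncludedOnReal 𝔑.beurling].TFAE ∧
    -- Roumieu into Roumieu
    [𝔐.RoumieuDominated 𝔑,
      𝔐.roumieu.Included 𝔑.roumieu,
      𝔐.roumieu.ContinuouslyIncluded 𝔑.roumieu,
      𝔐.roumieu.IncludedOnReal 𝔑.roumieu,
      𝔐.roumieu.ContinuouslyIncludedOnReal 𝔑.roumieu].TFAE ∧
    -- Roumieu into Beurling
    [𝔐.RoumieuBeurlingDominated 𝔑,
      𝔐.roumieu.Included 𝔑.beurling,
      𝔐.roumieu.ContinuouslyIncluded 𝔑.beurling,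
      𝔐.roumieu.IncludedOnReal 𝔑.beurling,
      𝔐.roumieu.ContinuouslyIncludedOnReal 𝔑.beurling].TFAE ∧
    -- Beurling into Roumieu
    [𝔐.BeurlingRoumieuDominated 𝔑,
      𝔐.beurling.Included 𝔑.roumieu,
      𝔐.beurling.ContinuouslyIncluded 𝔑.roumieu,
      𝔐.beurling.IncludedOnReal 𝔑.roumieu,
      𝔐.beurling.ContinuouslyIncludedOnReal 𝔑.roumieu].TFAE :=
  ⟨FunctionClass.tfae_inclusions 𝔐.beurling_isometryInvariant 𝔑.beurling_isometryInvariant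
      (fun h _ F _ _ _ _ U => exists_beurling_le_beurling F U h)
      WeightMatrix.beurlingDominated_of_le,
    FunctionClass.tfae_inclusions 𝔐.roumieu_isometryInvariant 𝔑.roumieu_isometryInvariant
      (fun h _ F _ _ _ _ U => exists_roumieu_le_roumieu F U h)
      WeightMatrix.roumieuDominated_of_le,
    FunctionClass.tfae_inclusions 𝔐.roumieu_isometryInvariant 𝔑.beurling_isometryInvariant
      (fun h _ F _ _ _ _ U => exists_roumieu_le_beurling F U h)
      WeightMatrix.roumieuBeurlingDominated_of_le,
    FunctionClass.tfae_inclusions 𝔐.beurling_isometryInvariant 𝔑.roumieu_isometryInvariant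
      (fun h _ F _ _ _ _ U => exists_beurling_le_roumieu F U h)
      WeightMatrix.beurlingRoumieuDominated_of_le⟩
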